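/- Let $p$ be a prime, let $\mathbb F$ be a field of characteristic $p$, and let $L$ be a restricted Lie algebra over $\mathbb F$, with $p$-map $x\mapsto x^{[p]}$, that is finite-dimensional and $p$-nilpotent (every $x\in L$ is killed by some iterate of the $p$-map). For a restricted Lie algebra $L$ write $u(L)$ for its restricted enveloping algebra, $\omega(L)$ for the augmentation ideal of $u(L)$, $L'=[L,L]$, $\gamma_3(L)=[L,[L,L]]$, $L'_p$ for the restricted Lie subalgebra generated by $L'$, $L'^p$ for the restricted Lie subalgebra generated by all $x^{[p]}$ with $x\in L'$, and $J_L=\omega(L)L'+L'\omega(L)\subseteq u(L)$. (1) The dimension of $L/(L'^p+\gamma_3(L))$ is determined by $u(L)$: if $H$ is any restricted Lie algebra over $\mathbb F$ such that $u(L)\cong u(H)$ as associative $\mathbb F$-algebras, then $H/(H'^p+\gamma_3(H))$ is finite-dimensional and $$\dim_{\mathbb F} L/(L'^p+\gamma_3(L))=\dim_{\mathbb F} H/(H'^p+\gamma_3(H)).$$ (2) The canonical map $L\to u(L)$ induces an isomorphism of $\mathbb F$-vector spaces $$L'_p/(L'^p+\gamma_3(L))\;\cong\; L'_pu(L)/J_L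 .$$ -/

import Mathlib

/-- `jacobsonCoeff x y n k` is the coefficient of `t ^ k` in `(ad (t • x + y)) ^ n (x)`, an element
of `L[t]`.  It is computed by the recursion `c (n + 1) k = ⁅y, c n k⁆ + ⁅x, c n (k - 1)⁆`. -/
def jacobsonCoeff {L : Type*} [LieRing L] (x y : L) : ℕ → ℕ → L
  | 0, 0 => x
  | 0, _ + 1 => 0
  | n + 1, 0 => ⁅y, jacobsonCoeff x y n 0⁆
  | n + 1, k + 1 => ⁅y, jacobsonCoeff x y n (k + 1)⁆ + ⁅x, jacobsonCoeff x y n k⁆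

/-- A restricted Lie algebra in the sense of Jacobson over a field `F` (of characteristic `p`):
a Lie algebra with a `p`-map `x ↦ x^[p]` such that
`ad (x^[p]) = (ad x)^p`, `(a x)^[p] = a^p x^[p]` and
`(x + y)^[p] = x^[p] + y^[p] + ∑_{i=1}^{p-1} s_i(x, y)`, where `i s_i(x, y)` is the coefficient
of `t^(i-1)` in `(ad (t x + y))^(p-1) (x)`. -/
class RestrictedLieAlgebra (p : ℕ) (F : Type*) (L : Type*) [Field F] [LieRing L]
    [LieAlgebra F L] where
  pMap : L → L
  ad_pMap : ∀ x : L, LieAlgebra.ad F L (pMap x) = LieAlgebra.ad F L x ^ p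
  pMap_smul : ∀ (a : F) (x : L), pMap (a • x) = a ^ p • pMap x
  pMap_add : ∀ x y : L, pMap (x + y) = pMap x + pMap y +
    ∑ i ∈ Finset.Icc 1 (p - 1), (i : F)⁻¹ • jacobsonCoeff x y (p - 1) (i - 1)

namespace RestrictedLieAlgebra

variable (p : ℕ) (F : Type*) (L : Type*) [Field F] [LieRing L] [LieAlgebra F L]
  [RestrictedLieAlgebra p F L]

/-- `L` is `p`-nilpotent: every element is killed by an iterate of the `p`-map. -/
def IsPNilpotent : Prop :=
  ∀ x : L, ∃ n : ℕ, (pMap p F : L → L)^[n] x = 0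

/-- The relations `x ^ p = x^[p]` (`x ∈ L`) in the universal enveloping algebra of `L`. -/
inductive EnvelopingRel : UniversalEnvelopingAlgebra F L → UniversalEnvelopingAlgebra F L → Prop
  | pow (x : L) : EnvelopingRel (UniversalEnvelopingAlgebra.ι F x ^ p)
      (UniversalEnvelopingAlgebra.ι F (pMap p F x))

/-- The restricted enveloping algebra `u(L)`. -/
abbrev RestrictedEnveloping : Type _ := RingQuot (EnvelopingRel p F L)

section associative

attribute [local instance 100] LieRing.ofAssociativeRing

/-- The canonical linear map `L → u(L)`. -/
noncomputable def uι : L →ₗ[F] RestrictedEnveloping p F L :=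
  (RingQuot.mkAlgHom F (EnvelopingRel p F L)).toLinearMap ∘ₗ
    (UniversalEnvelopingAlgebra.ι F : L →ₗ⁅F⁆ UniversalEnvelopingAlgebra F L).toLinearMap

/-- The augmentation map `u(L) → F`, the algebra map induced by `x ↦ 0` for `x ∈ L`. -/
noncomputable def augmentation [Fact p.Prime] : RestrictedEnveloping p F L →ₐ[F] F :=
  RingQuot.liftAlgHom F ⟨UniversalEnvelopingAlgebra.lift F (0 : L →ₗ⁅F⁆ F), by
    rintro _ _ ⟨x⟩
    rw [map_pow, UniversalEnvelopingAlgebra.lift_ι_apply, UniversalEnvelopingAlgebra.lift_ι_apply]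
    simp [(Fact.out : p.Prime).ne_zero]⟩

end associative

/-- The augmentation ideal `ω(L)` of `u(L)`, as a subspace. -/
noncomputable def augmentationIdeal [Fact p.Prime] : Submodule F (RestrictedEnveloping p F L) :=
  LinearMap.ker (augmentation p F L).toLinearMap

variable {L} in
/-- The restricted Lie subalgebra of `L` generated by a set `S`. -/
def restrictedClosure (S : Set L) : LieSubalgebra F L :=
  sInf {K : LieSubalgebra F L | S ⊆ K ∧ ∀ x ∈ K, pMap p F x ∈ K}

/-- The derived subalgebra `L' = γ₂(L) = [L, L]`. -/
abbrev derivedIdeal (F : Type*) (L : Type*) [Field F] [LieRing L] [LieAlgebra F L] :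
    LieIdeal F L :=
  LieModule.lowerCentralSeries F L L 1

/-- `γ₃(L) = [L, [L, L]]`; Mathlib numbers the lower central series from `0`. -/
abbrev gammaThree (F : Type*) (L : Type*) [Field F] [LieRing L] [LieAlgebra F L] :
    LieIdeal F L :=
  LieModule.lowerCentralSeries F L L 2

/-- `L'_p`, the restricted Lie subalgebra generated by `L'`. -/
def derivedRestricted : LieSubalgebra F L :=
  restrictedClosure p F (derivedIdeal F L : Set L)

/-- `L'^p`, the restricted Lie subalgebra generated by all `x^[p]` with `x ∈ L'`. -/
def derivedPower : LieSubalgebra F L :=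
  restrictedClosure p F (pMap p F '' (derivedIdeal F L : Set L))

/-- The subspace `L'^p + γ₃(L)` of `L`. -/
def derivedPowerAddGamma : Submodule F L :=
  (derivedPower p F L).toSubmodule ⊔ (gammaThree F L).toSubmodule

/-- The subspace `L'_p u(L)` of `u(L)`. -/
noncomputable def derivedMulU : Submodule F (RestrictedEnveloping p F L) :=
  (derivedRestricted p F L).toSubmodule.map (uι p F L) * ⊤

/-- `J_L = ω(L) L' + L' ω(L)`. -/
noncomputable def idealJ [Fact p.Prime] : Submodule F (RestrictedEnveloping p F L) :=
  augmentationIdeal p F L * (derivedIdeal F L).toSubmodule.map (uι p F L) ⊔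
    (derivedIdeal F L).toSubmodule.map (uι p F L) * augmentationIdeal p F L

/-- The image of `L'_p` in `u(L)` lies in `L'_p u(L)`. -/
theorem uι_mem_derivedMulU (x : (derivedRestricted p F L).toSubmodule) :
    uι p F L x ∈ derivedMulU p F L := by
  have h := Submodule.mul_mem_mul (Submodule.mem_map_of_mem (f := uι p F L) x.2)
    (Submodule.mem_top (R := F) (x := (1 : RestrictedEnveloping p F L)))
  rwa [mul_one] at h

end RestrictedLieAlgebra

/-! Write `C = L'_p u(L)` and `ω = ω(L)`. Since `C = L' u(L)` and `u(L) = F + ω`, every element of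
`C` lies in `L' + J_L`. Also `γ₃(L)` and the `p`-th powers of `L'` lie in `J_L`, through `[a, l] = a
l - l a` and `l^[p] = l · l^(p-1)`. So the map in (2) is well defined and surjective. The real
content is injectivity: an element of `L'_p` whose image lies in `J_L` must lie in `L'^p + γ₃(L)`.

Injectivity comes from an explicit quotient of `u(L)`, with no appeal to a PBW theorem. Let `σ`
index a basis of `L/L'_p` and put `M = L/(L'^p + γ₃(L))`. The bracket induces an alternating map
`L/L'_p × L/L'_p → M`, which is the alternation of a bilinear `β`. Twisting `F[σ] × M` by the
cocycle `β` (linear part, linear part) gives an algebra, `CupExtension`, to which `L` maps as a Lie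
algebra. The `p`-map is respected up to a defect, which is additive, `p`-semilinear, zero on `L'_p`
and central on lifts of basis vectors. Dividing by the defects `z i` of the basis lifts yields an
algebra map from `u(L)` (`exists_algHom_cupExtension`). It kills `J_L`, because `u(L)` acts on `M`
through the augmentation. It loses nothing of `M`, because the first component of `z i` is `X i ^ p`
minus a linear form, so the ideal of the `z i` meets `M` in zero
(`CupExtension.eq_zero_of_mem_span`).

For (1), the dimension is `dim L/L'_p + dim L'_p/(L'^p + γ₃(L))`, and the second term is `dim C/J_L`
by (2). Here `C` is the ideal generated by commutators and `J_L = ω C + C ω`; `p`-nilpotence makes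
the augmentation the only algebra map `u(L) → F`, so an isomorphism carries all of this to `u(H)`.
The first term is read off the largest commutative quotient of `u(L)`, which is `F[σ]` modulo the
relations `abelianRel` and has dimension `p ^ |σ|`. -/

namespace RestrictedLieAlgebra

/-! ### Brackets and `p`-powers in `L'_p` modulo `L'^p + γ₃(L)` -/

section facts

variable (p : ℕ) {F L : Type*} [Field F] [LieRing L] [LieAlgebra F L]

/-- If `y` lies in a Lie ideal, then all Jacobson coefficients that involve `y` lie in it. -/
theorem jacobsonCoeff_mem (I : Submodule F L) {x y : L} (hxy : ⁅y, x⁆ ∈ I)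
    (hI : ∀ a b : L, b ∈ I → ⁅a, b⁆ ∈ I) :
    ∀ n k : ℕ, k < n → jacobsonCoeff x y n k ∈ I := by
  -- The top coefficient `(ad x)^n x` is `x` for `n = 0` and zero afterwards. It need not lie in `I`
  -- when `n = 0`, so only its brackets are tracked; they close the recursion at `k = n - 1`.
  have key : ∀ n k : ℕ, (k < n → jacobsonCoeff x y n k ∈ I) ∧
      ⁅x, jacobsonCoeff x y n n⁆ = 0 ∧ ⁅y, jacobsonCoeff x y n n⁆ ∈ I ∧
      (n < k → jacobsonCoeff x y n k = 0) := by
    intro n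
    induction n with
    | zero =>
      intro k
      refine ⟨by omega, by simp [jacobsonCoeff], by simpa [jacobsonCoeff] using hxy, ?_⟩
      intro hk
      obtain ⟨k, rfl⟩ := Nat.exists_eq_add_of_lt hk
      simp [jacobsonCoeff]
    | succ n ih =>
      intro k
      have top : jacobsonCoeff x y (n + 1) (n + 1) = 0 := by
        simp [jacobsonCoeff, (ih (n + 1)).2.2.2, (ih n).2.1]
      refine ⟨?_, by simp [top], by simp [top], ?_⟩
      · intro hk
        cases k with
        | zero =>
          simp only [jacobsonCoeff]
          rcases Nat.eq_zero_or_pos n with rfl | hn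
          · exact (ih 0).2.2.1
          · exact hI _ _ ((ih 0).1 hn)
        | succ k =>
          simp only [jacobsonCoeff]
          refine I.add_mem ?_ (hI _ _ ((ih k).1 (by omega)))
          rcases Nat.lt_or_ge (k + 1) n with h | h
          · exact hI _ _ ((ih (k + 1)).1 h)
          · obtain rfl : n = k + 1 := by omega
            exact (ih 0).2.2.1
      · intro hk
        cases k with
        | zero => omega
        | succ k =>
          simp only [jacobsonCoeff]
          simp [(ih (k + 1)).2.2.2 (by omega), (ih k).2.2.2 (by omega)]
  exact fun n k h => (key n k).1 h

theorem lie_mem_derivedIdeal (x y : L) : ⁅x, y⁆ ∈ derivedIdeal F L := by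
  rw [derivedIdeal, LieModule.lowerCentralSeries_succ]
  exact LieSubmodule.lie_mem_lie (LieSubmodule.mem_top _) (by simp)

theorem lie_mem_gammaThree {x y : L} (hy : y ∈ derivedIdeal F L) : ⁅x, y⁆ ∈ gammaThree F L := by
  rw [gammaThree, LieModule.lowerCentralSeries_succ]
  exact LieSubmodule.lie_mem_lie (LieSubmodule.mem_top _) hy

theorem jacobsonCoeff_mem_derivedIdeal (x y : L) (n k : ℕ) :
    jacobsonCoeff x y (n + 1) k ∈ derivedIdeal F L := by
  cases k with
  | zero => exact lie_mem_derivedIdeal _ _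
  | succ k => exact add_mem (lie_mem_derivedIdeal _ _) (lie_mem_derivedIdeal _ _)

theorem jacobsonCoeff_mem_gammaThree (x y : L) (n k : ℕ) :
    jacobsonCoeff x y (n + 2) k ∈ gammaThree F L := by
  cases k with
  | zero => exact lie_mem_gammaThree (jacobsonCoeff_mem_derivedIdeal _ _ _ _)
  | succ k =>
    exact add_mem (lie_mem_gammaThree (jacobsonCoeff_mem_derivedIdeal _ _ _ _))
      (lie_mem_gammaThree (jacobsonCoeff_mem_derivedIdeal _ _ _ _))

variable [RestrictedLieAlgebra p F L]

/-- The `p`-map is additive modulo any Lie ideal containing the bracket of the summands. -/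
theorem pMap_add_sub_mem (I : Submodule F L) {x y : L} (hxy : ⁅y, x⁆ ∈ I)
    (hI : ∀ a b : L, b ∈ I → ⁅a, b⁆ ∈ I) :
    pMap p F (x + y) - (pMap p F x + pMap p F y) ∈ I := by
  rw [pMap_add, add_sub_cancel_left]
  refine I.sum_mem fun i hi => I.smul_mem _ (jacobsonCoeff_mem I hxy hI _ _ ?_)
  rw [Finset.mem_Icc] at hi
  omega

theorem pMap_lie (x y : L) : ⁅pMap p F x, y⁆ = (LieAlgebra.ad F L x ^ p) y := by
  rw [← ad_pMap, LieAlgebra.ad_apply]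

theorem pMap_zero [Fact p.Prime] : pMap p F (0 : L) = 0 := by
  have := pMap_smul (p := p) (F := F) (0 : F) (0 : L)
  simpa [(Fact.out : p.Prime).ne_zero] using this

variable {p}

theorem mem_restrictedClosure {S : Set L} {x : L} :
    x ∈ restrictedClosure p F S ↔
      ∀ K : LieSubalgebra F L, S ⊆ K → (∀ x ∈ K, pMap p F x ∈ K) → x ∈ K := by
  rw [restrictedClosure, ← SetLike.mem_coe, LieSubalgebra.coe_sInf]
  simp only [Set.mem_ofPred_eq, Set.mem_iInter, SetLike.mem_coe, and_imp]

theorem subset_restrictedClosure {S : Set L} : S ⊆ restrictedClosure p F S :=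
  fun _ hx => mem_restrictedClosure.2 fun _ hK _ => hK hx

theorem pMap_mem_restrictedClosure {S : Set L} {x : L} (hx : x ∈ restrictedClosure p F S) :
    pMap p F x ∈ restrictedClosure p F S :=
  mem_restrictedClosure.2 fun K hK h => h _ (mem_restrictedClosure.1 hx K hK h)

theorem gammaThree_le_derivedIdeal : gammaThree F L ≤ derivedIdeal F L :=
  LieModule.antitone_lowerCentralSeries F L L (by norm_num)

/-- A linear subspace containing all brackets `⁅x, y⁆` with `y ∈ L'` contains `γ₃(L)`. -/
theorem gammaThree_le {W : Submodule F L}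
    (h : ∀ x y : L, y ∈ derivedIdeal F L → ⁅x, y⁆ ∈ W) : (gammaThree F L).toSubmodule ≤ W := by
  rw [gammaThree, LieModule.lowerCentralSeries_succ, LieSubmodule.lieIdeal_oper_eq_linear_span',
    Submodule.span_le]
  rintro _ ⟨x, -, y, hy, rfl⟩
  exact h x y hy

theorem derivedIdeal_le_span :
    (derivedIdeal F L).toSubmodule ≤ Submodule.span F {z | ∃ x y : L, ⁅x, y⁆ = z} := by
  rw [derivedIdeal, LieModule.lowerCentralSeries_succ, LieSubmodule.lieIdeal_oper_eq_linear_span',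
    Submodule.span_le]
  rintro _ ⟨x, -, y, hy, rfl⟩
  exact Submodule.subset_span ⟨x, y, rfl⟩

theorem lie_gammaThree_mem (a b : L) (hb : b ∈ (gammaThree F L).toSubmodule) :
    ⁅a, b⁆ ∈ (gammaThree F L).toSubmodule :=
  (gammaThree F L).lie_mem hb

theorem ad_pow_mem_of_le {F L : Type*} [Field F] [LieRing L] [LieAlgebra F L] {p : ℕ}
    [Fact p.Prime] {W : Submodule F L} (hW : ∀ a b : L, b ∈ W → ⁅a, b⁆ ∈ W)
    {x y : L} (hxy : ⁅x, y⁆ ∈ W) : (LieAlgebra.ad F L x ^ p) y ∈ W := by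
  obtain ⟨n, hn⟩ := Nat.exists_eq_succ_of_ne_zero (Fact.out : p.Prime).ne_zero
  rw [hn]
  clear hn
  induction n with
  | zero => simpa using hxy
  | succ n ih =>
    rw [pow_succ', Module.End.mul_apply, LieAlgebra.ad_apply]
    exact hW _ _ ih

theorem pMap_lie_mem_gammaThree [Fact p.Prime] (x y : L) :
    ⁅pMap p F x, y⁆ ∈ gammaThree F L := by
  obtain ⟨n, hn⟩ := Nat.exists_eq_add_of_le' (Fact.out : p.Prime).two_le
  rw [pMap_lie, hn, pow_succ', pow_succ', Module.End.mul_apply, Module.End.mul_apply]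
  exact lie_mem_gammaThree (lie_mem_derivedIdeal _ _)

theorem mem_derivedRestricted_of_mem_derivedIdeal {x : L} (hx : x ∈ derivedIdeal F L) :
    x ∈ derivedRestricted p F L :=
  subset_restrictedClosure hx

theorem derivedPower_le : derivedPower p F L ≤ derivedRestricted p F L := by
  intro x hx
  refine mem_restrictedClosure.1 hx _ ?_ fun _ => pMap_mem_restrictedClosure
  rintro _ ⟨y, hy, rfl⟩
  exact pMap_mem_restrictedClosure (subset_restrictedClosure hy)

theorem derivedPowerAddGamma_le :
    derivedPowerAddGamma p F L ≤ (derivedRestricted p F L).toSubmodule :=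
  sup_le derivedPower_le fun _ hx =>
    mem_derivedRestricted_of_mem_derivedIdeal (gammaThree_le_derivedIdeal hx)

/-- The elements that bracket `L` into `γ₃` form a restricted subalgebra: the Jacobi identity
handles brackets, and `ad (x^[p]) = (ad x)^p` handles the `p`-map. This subalgebra contains `L'`. -/
theorem lie_mem_gammaThree_of_mem_derivedRestricted [Fact p.Prime] {x : L} (hx : x ∈ derivedRestricted p F L)
    (y : L) : ⁅x, y⁆ ∈ (gammaThree F L).toSubmodule := by
  let K : LieSubalgebra F L :=
    { carrier := {x | ∀ y, ⁅x, y⁆ ∈ (gammaThree F L).toSubmodule}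
      add_mem' := fun {a b} ha hb y => by
        rw [add_lie]; exact Submodule.add_mem _ (ha y) (hb y)
      zero_mem' := fun y => by simp
      smul_mem' := fun c a ha y => by
        rw [smul_lie]; exact Submodule.smul_mem _ _ (ha y)
      lie_mem' := fun {a b} ha hb y => by
        rw [lie_lie]
        exact Submodule.sub_mem _ (lie_gammaThree_mem _ _ (hb y)) (lie_gammaThree_mem _ _ (ha y)) }
  refine mem_restrictedClosure.1 hx K ?_ ?_ y
  · intro a ha y
    rw [← lie_skew]
    exact Submodule.neg_mem _ (lie_mem_gammaThree ha)
  · intro a ha y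
    rw [pMap_lie]
    exact ad_pow_mem_of_le lie_gammaThree_mem (ha y)

theorem gammaThree_le_derivedPowerAddGamma :
    (gammaThree F L).toSubmodule ≤ derivedPowerAddGamma p F L :=
  le_sup_right

theorem pMap_mem_derivedPowerAddGamma_of_mem_derivedIdeal {x : L} (hx : x ∈ derivedIdeal F L) :
    pMap p F x ∈ derivedPowerAddGamma p F L :=
  (le_sup_left : _ ≤ derivedPowerAddGamma p F L) (subset_restrictedClosure ⟨x, hx, rfl⟩)

/-- Modulo `γ₃` the `p`-map is additive on `L'_p`, since `[L'_p, L] ⊆ γ₃`. Hence the elements with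
this property form a restricted subalgebra. -/
theorem pMap_mem_derivedPowerAddGamma [Fact p.Prime] {x : L} (hx : x ∈ derivedRestricted p F L) :
    pMap p F x ∈ derivedPowerAddGamma p F L := by
  have hadd : ∀ {a b : L}, a ∈ derivedRestricted p F L →
      pMap p F a ∈ derivedPowerAddGamma p F L →
      pMap p F b ∈ derivedPowerAddGamma p F L → pMap p F (a + b) ∈ derivedPowerAddGamma p F L := by
    intro a b ha ha' hb'
    have h := pMap_add_sub_mem p (gammaThree F L).toSubmodule (x := a) (y := b)
      (by rw [← lie_skew]; exact Submodule.neg_mem _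
            (lie_mem_gammaThree_of_mem_derivedRestricted ha b)) lie_gammaThree_mem
    have := Submodule.add_mem _ (gammaThree_le_derivedPowerAddGamma (p := p) h)
      (Submodule.add_mem _ ha' hb')
    rwa [sub_add_cancel] at this
  let K : LieSubalgebra F L :=
    { carrier := {x | x ∈ derivedRestricted p F L ∧ pMap p F x ∈ derivedPowerAddGamma p F L}
      add_mem' := fun {a b} ha hb => ⟨add_mem ha.1 hb.1, hadd ha.1 ha.2 hb.2⟩
      zero_mem' := ⟨zero_mem _, by rw [pMap_zero]; exact zero_mem _⟩
      smul_mem' := fun c a ha => ⟨(derivedRestricted p F L).smul_mem c ha.1, by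
        rw [pMap_smul]; exact Submodule.smul_mem _ _ ha.2⟩
      lie_mem' := fun {a b} ha hb => ⟨(derivedRestricted p F L).lie_mem ha.1 hb.1,
        pMap_mem_derivedPowerAddGamma_of_mem_derivedIdeal (lie_mem_derivedIdeal a b)⟩ }
  refine (mem_restrictedClosure.1 hx K ?_ ?_).2
  · intro a ha
    exact ⟨mem_derivedRestricted_of_mem_derivedIdeal ha,
      pMap_mem_derivedPowerAddGamma_of_mem_derivedIdeal ha⟩
  · rintro a ⟨ha, ha'⟩
    refine ⟨pMap_mem_restrictedClosure ha, ?_⟩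
    -- For closure under the `p`-map, `a^[p] = b + c` with `b ∈ L'^p`, which is itself closed, and
    -- `c ∈ γ₃ ⊆ L'`.
    obtain ⟨b, hb, c, hc, h⟩ := Submodule.mem_sup.1 ha'
    rw [← h]
    exact hadd (derivedPower_le hb)
      ((le_sup_left : _ ≤ derivedPowerAddGamma p F L) (pMap_mem_restrictedClosure hb))
      (pMap_mem_derivedPowerAddGamma_of_mem_derivedIdeal (gammaThree_le_derivedIdeal hc))

end facts

/-! ### The universal property of `u(L)` -/

section enveloping

variable {p : ℕ} {F L : Type*} [Field F] [LieRing L] [LieAlgebra F L] [RestrictedLieAlgebra p F L]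

attribute [local instance 100] LieRing.ofAssociativeRing

theorem uι_apply (x : L) : uι p F L x =
    RingQuot.mkAlgHom F (EnvelopingRel p F L) (UniversalEnvelopingAlgebra.ι F x) := rfl

theorem uι_lie (x y : L) :
    uι p F L ⁅x, y⁆ = uι p F L x * uι p F L y - uι p F L y * uι p F L x := by
  simp only [uι_apply, LieHom.map_lie, LieRing.of_associative_ring_bracket, map_sub, map_mul]

theorem uι_pow (x : L) : uι p F L x ^ p = uι p F L (pMap p F x) := by
  rw [uι_apply, uι_apply, ← map_pow]
  exact RingQuot.mkAlgHom_rel F (EnvelopingRel.pow x)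

theorem exists_algHom_of_linearMap {S : Type*} [Ring S] [Algebra F S] (f : L →ₗ[F] S)
    (h₁ : ∀ x y, f ⁅x, y⁆ = f x * f y - f y * f x) (h₂ : ∀ x, f x ^ p = f (pMap p F x)) :
    ∃ g : RestrictedEnveloping p F L →ₐ[F] S, ∀ x, g (uι p F L x) = f x := by
  let f' : L →ₗ⁅F⁆ S := { f with map_lie' := fun {x y} => h₁ x y }
  refine ⟨RingQuot.liftAlgHom F ⟨UniversalEnvelopingAlgebra.lift F f', ?_⟩, fun x => ?_⟩
  · rintro _ _ ⟨x⟩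
    rw [map_pow, UniversalEnvelopingAlgebra.lift_ι_apply, UniversalEnvelopingAlgebra.lift_ι_apply]
    exact h₂ x
  · rw [uι_apply, RingQuot.liftAlgHom_mkAlgHom_apply, UniversalEnvelopingAlgebra.lift_ι_apply]
    rfl

theorem restrictedEnveloping_hom_ext {S : Type*} [Ring S] [Algebra F S]
    {f g : RestrictedEnveloping p F L →ₐ[F] S} (h : ∀ x, f (uι p F L x) = g (uι p F L x)) :
    f = g := by
  refine RingQuot.ringQuot_ext' F f g ?_
  refine UniversalEnvelopingAlgebra.hom_ext F (LieHom.ext fun x => ?_)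
  exact h x

theorem adjoin_range_uι : Algebra.adjoin F (Set.range (uι p F L)) = ⊤ := by
  let S := Algebra.adjoin F (Set.range (uι p F L))
  have hmem : ∀ x, uι p F L x ∈ S := fun x => Algebra.subset_adjoin ⟨x, rfl⟩
  obtain ⟨g, hg⟩ := exists_algHom_of_linearMap (p := p) (S := S)
    ((uι p F L).codRestrict (Subalgebra.toSubmodule S) hmem)
    (fun x y => Subtype.ext (uι_lie x y)) (fun x => Subtype.ext (uι_pow x))
  have h : S.val.comp g = AlgHom.id F _ :=
    restrictedEnveloping_hom_ext fun x => by
      rw [AlgHom.comp_apply, hg]; rfl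
  refine Algebra.eq_top_iff.2 fun a => ?_
  rw [← AlgHom.id_apply (R := F) a, ← h]
  exact (g a).2

theorem restrictedEnveloping_induction {P : RestrictedEnveloping p F L → Prop}
    (algebraMap : ∀ c : F, P (algebraMap F _ c)) (ι : ∀ x, P (uι p F L x))
    (add : ∀ a b, P a → P b → P (a + b)) (mul : ∀ a b, P a → P b → P (a * b)) (a) : P a := by
  have ha : a ∈ Algebra.adjoin F (Set.range (uι p F L)) := by
    rw [adjoin_range_uι]; trivial
  induction ha using Algebra.adjoin_induction with
  | mem x hx => obtain ⟨x, rfl⟩ := hx; exact ι x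
  | algebraMap c => exact algebraMap c
  | add a b _ _ ha hb => exact add a b ha hb
  | mul a b _ _ ha hb => exact mul a b ha hb

theorem augmentation_uι [Fact p.Prime] (x : L) : augmentation p F L (uι p F L x) = 0 := by
  rw [uι_apply, augmentation, RingQuot.liftAlgHom_mkAlgHom_apply,
    UniversalEnvelopingAlgebra.lift_ι_apply]
  rfl

end enveloping

end RestrictedLieAlgebra

/-! ### Degree filtration and triangular expansions of polynomials -/

namespace MvPolynomial

variable {σ F : Type*} [Field F]

/-- The polynomials all of whose monomials have degree less than `d`. -/
noncomputable def degreeLT (σ F : Type*) [Field F] (d : ℕ) : Submodule F (MvPolynomial σ F) :=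
  restrictSupport F {m | m.degree < d}

theorem mem_degreeLT {d : ℕ} {f : MvPolynomial σ F} :
    f ∈ degreeLT σ F d ↔ ∀ m ∈ f.support, m.degree < d := Iff.rfl

theorem mul_mem_degreeLT {a b : ℕ} {f g : MvPolynomial σ F} (hf : f ∈ degreeLT σ F a)
    (hg : g ∈ degreeLT σ F b) : f * g ∈ degreeLT σ F (a + b - 1) := by
  classical
  intro m hm
  obtain ⟨m₁, h₁, m₂, h₂, rfl⟩ := Finset.mem_add.1 (support_mul f g hm)
  have := mem_degreeLT.1 hf m₁ h₁
  have := mem_degreeLT.1 hg m₂ h₂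
  change (m₁ + m₂).degree < _
  rw [map_add]
  omega

theorem degreeLT_mono {a b : ℕ} (h : a ≤ b) : degreeLT σ F a ≤ degreeLT σ F b :=
  fun _ hf m hm => (mem_degreeLT.1 hf m hm).trans_le h

theorem monomial_mem_degreeLT {m : σ →₀ ℕ} {d : ℕ} (h : m.degree < d) (c : F) :
    monomial m c ∈ degreeLT σ F d := by
  intro n hn
  have := support_monomial_subset hn
  rw [Finset.mem_singleton] at this
  subst this
  exact h

theorem exists_mem_degreeLT (f : MvPolynomial σ F) : ∃ d, f ∈ degreeLT σ F d := by
  refine ⟨f.support.sup (fun m => m.degree) + 1, fun m hm => ?_⟩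
  exact Nat.lt_succ_of_le (Finset.le_sup (f := fun m : σ →₀ ℕ => m.degree) hm)

theorem degreeLT_le {d : ℕ} {W : Submodule F (MvPolynomial σ F)}
    (h : ∀ m : σ →₀ ℕ, m.degree < d → monomial m 1 ∈ W) : degreeLT σ F d ≤ W := by
  intro f hf
  rw [f.as_sum]
  refine W.sum_mem fun m hm => ?_
  have e : monomial m (coeff m f) = coeff m f • monomial m (1 : F) := by
    rw [smul_monomial, smul_eq_mul, mul_one]
  rw [e]
  exact W.smul_mem _ (h m (mem_degreeLT.1 hf m hm))

/-- A linear endomorphism of a polynomial ring that is the identity up to terms of lower degree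
is bijective. -/
theorem bijective_of_sub_mem_degreeLT (T : MvPolynomial σ F →ₗ[F] MvPolynomial σ F)
    (hT : ∀ m : σ →₀ ℕ, T (monomial m 1) - monomial m 1 ∈ degreeLT σ F m.degree) :
    Function.Bijective T := by
  have hT' : ∀ d f, f ∈ degreeLT σ F (d + 1) → T f - f ∈ degreeLT σ F d := by
    intro d f hf
    have h : degreeLT σ F (d + 1) ≤ (degreeLT σ F d).comap (T - LinearMap.id) :=
      degreeLT_le fun m hm => Submodule.mem_comap.2 (degreeLT_mono (Nat.le_of_lt_succ hm) (hT m))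
    exact Submodule.mem_comap.1 (h hf)
  have hzero : ∀ f : MvPolynomial σ F, f ∈ degreeLT σ F 0 → f = 0 := by
    intro f hf
    rw [← support_eq_empty, Finset.eq_empty_iff_forall_notMem]
    exact fun m hm => absurd (mem_degreeLT.1 hf m hm) (by omega)
  constructor
  · rw [injective_iff_map_eq_zero]
    intro f hf
    obtain ⟨d, hd⟩ := exists_mem_degreeLT f
    induction d with
    | zero => exact hzero f hd
    | succ d ih =>
      refine ih ?_
      have := hT' d f hd
      rw [hf, zero_sub] at this
      simpa using Submodule.neg_mem _ this
  · rw [← LinearMap.range_eq_top, eq_top_iff]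
    intro f _
    obtain ⟨d, hd⟩ := exists_mem_degreeLT f
    induction d generalizing f with
    | zero => rw [hzero f hd]; exact zero_mem _
    | succ d ih =>
      have h := ih Submodule.mem_top (hT' d f hd)
      have := Submodule.sub_mem _ (LinearMap.mem_range_self T f) h
      rwa [sub_sub_cancel] at this

section

variable (p : ℕ)

/-- The exponentwise remainder of a multi-index modulo `p`. -/
noncomputable def modExp (m : σ →₀ ℕ) : σ →₀ ℕ := m.mapRange (· % p) (Nat.zero_mod p)

/-- The exponentwise quotient of a multi-index by `p`. -/
noncomputable def divExp (m : σ →₀ ℕ) : σ →₀ ℕ := m.mapRange (· / p) (Nat.zero_div p)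

theorem modExp_add_smul_divExp (m : σ →₀ ℕ) : modExp p m + p • divExp p m = m := by
  ext i
  simp [modExp, divExp, Nat.mod_add_div]

/-- Leading terms multiply, by `AB - ab = (A - a)(B - b) + (A - a)b + a(B - b)`; each summand has
lower degree than `ab`. -/
theorem aeval_monomial_sub_mem {p : ℕ} (hp : 1 < p) (φ : σ → MvPolynomial σ F)
    (hφ : ∀ i, φ i - X i ^ p ∈ degreeLT σ F p) (m : σ →₀ ℕ) :
    aeval φ (monomial m (1 : F)) - monomial (p • m) 1 ∈ degreeLT σ F (p * m.degree) := by
  induction m using Finsupp.induction_linear with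
  | zero => simp
  | add m n hm hn =>
    have e₁ : monomial (m + n) (1 : F) = monomial m 1 * monomial n 1 := by simp
    have e₂ : monomial (p • (m + n)) (1 : F) = monomial (p • m) 1 * monomial (p • n) 1 := by simp
    have e : aeval φ (monomial (m + n) (1 : F)) - monomial (p • (m + n)) 1 =
        (aeval φ (monomial m (1 : F)) - monomial (p • m) 1) *
          (aeval φ (monomial n (1 : F)) - monomial (p • n) 1) +
        (aeval φ (monomial m (1 : F)) - monomial (p • m) 1) * monomial (p • n) 1 +
        monomial (p • m) 1 * (aeval φ (monomial n (1 : F)) - monomial (p • n) 1) := by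
      rw [e₁, e₂, map_mul]; ring
    rw [e]
    have h₁ : monomial (p • m) (1 : F) ∈ degreeLT σ F (p * m.degree + 1) :=
      monomial_mem_degreeLT (by rw [map_nsmul]; simp) 1
    have h₂ : monomial (p • n) (1 : F) ∈ degreeLT σ F (p * n.degree + 1) :=
      monomial_mem_degreeLT (by rw [map_nsmul]; simp) 1
    have hd : p * (m + n).degree = p * m.degree + p * n.degree := by rw [map_add, mul_add]
    refine Submodule.add_mem _ (Submodule.add_mem _ ?_ ?_) ?_
    · exact degreeLT_mono (by omega) (mul_mem_degreeLT hm hn)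
    · exact degreeLT_mono (by omega) (mul_mem_degreeLT hm h₂)
    · exact degreeLT_mono (by omega) (mul_mem_degreeLT h₁ hn)
  | single i k =>
    have hX : X i ^ p ∈ degreeLT σ F (p + 1) := by
      rw [X_pow_eq_monomial]
      exact monomial_mem_degreeLT (by simp) 1
    have e₂ : ∀ k : ℕ, monomial (p • Finsupp.single i k) (1 : F) = (X i ^ p) ^ k := by
      intro k
      rw [← pow_mul, X_pow_eq_monomial, Finsupp.smul_single, smul_eq_mul]
    have e₁ : ∀ k : ℕ, aeval φ (monomial (Finsupp.single i k) (1 : F)) = φ i ^ k := by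
      intro k
      rw [← X_pow_eq_monomial, map_pow, aeval_X]
    rw [e₁, e₂, Finsupp.degree_single]
    induction k with
    | zero => simp
    | succ k ih =>
      have e : φ i ^ (k + 1) - (X i ^ p) ^ (k + 1) =
          (φ i ^ k - (X i ^ p) ^ k) * (φ i - X i ^ p) +
          (φ i ^ k - (X i ^ p) ^ k) * X i ^ p + (X i ^ p) ^ k * (φ i - X i ^ p) := by ring
      have hk : (X i ^ p) ^ k ∈ degreeLT σ F (p * k + 1) := by
        rw [← pow_mul, X_pow_eq_monomial]
        exact monomial_mem_degreeLT (by rw [Finsupp.degree_single]; omega) 1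
      have hd : p * (k + 1) = p * k + p := by ring
      rw [e]
      refine Submodule.add_mem _ (Submodule.add_mem _ ?_ ?_) ?_
      · exact degreeLT_mono (by omega) (mul_mem_degreeLT ih (hφ i))
      · exact degreeLT_mono (by omega) (mul_mem_degreeLT ih hX)
      · exact degreeLT_mono (by omega) (mul_mem_degreeLT hk (hφ i))

/-- The linear endomorphism sending a monomial `X ^ (α + p β)`, all entries of `α` being less
than `p`, to `X ^ α * φ ^ β`. -/
noncomputable def restrictedExpansion (φ : σ → MvPolynomial σ F) :
    MvPolynomial σ F →ₗ[F] MvPolynomial σ F :=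
  (basisMonomials σ F).constr F fun m =>
    monomial (modExp p m) 1 * aeval φ (monomial (divExp p m) (1 : F))

theorem restrictedExpansion_monomial (φ : σ → MvPolynomial σ F) (m : σ →₀ ℕ) :
    restrictedExpansion p φ (monomial m 1) =
      monomial (modExp p m) 1 * aeval φ (monomial (divExp p m) (1 : F)) := by
  have h := (basisMonomials σ F).constr_basis F (fun m =>
    monomial (modExp p m) 1 * aeval φ (monomial (divExp p m) (1 : F))) m
  rwa [coe_basisMonomials] at h

/-- The leading term of `X ^ α * φ ^ β` is `X ^ (α + p β)`, so the map is unitriangular for the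
degree filtration. -/
theorem restrictedExpansion_bijective {p : ℕ} (hp : 1 < p) (φ : σ → MvPolynomial σ F)
    (hφ : ∀ i, φ i - X i ^ p ∈ degreeLT σ F p) : Function.Bijective (restrictedExpansion p φ) := by
  refine bijective_of_sub_mem_degreeLT _ fun m => ?_
  have hm := modExp_add_smul_divExp p m
  have e : monomial m (1 : F) = monomial (modExp p m) 1 * monomial (p • divExp p m) 1 := by
    rw [monomial_mul, hm, mul_one]
  have hd : m.degree = (modExp p m).degree + p * (divExp p m).degree := by
    conv_lhs => rw [← hm]
    rw [map_add, map_nsmul, smul_eq_mul]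
  rw [restrictedExpansion_monomial, e, ← mul_sub, hd]
  have h := mul_mem_degreeLT
    (monomial_mem_degreeLT (Nat.lt_succ_self (modExp p m).degree) (1 : F))
    (aeval_monomial_sub_mem hp φ hφ (divExp p m))
  exact degreeLT_mono (by omega) h

theorem modExp_add_single (m : σ →₀ ℕ) (i : σ) :
    modExp p (m + Finsupp.single i p) = modExp p m := by
  classical
  ext j
  simp only [modExp, Finsupp.mapRange_apply, Finsupp.add_apply, Finsupp.single_apply]
  split_ifs <;> simp

theorem divExp_add_single {p : ℕ} (hp : 0 < p) (m : σ →₀ ℕ) (i : σ) :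
    divExp p (m + Finsupp.single i p) = divExp p m + Finsupp.single i 1 := by
  classical
  ext j
  simp only [divExp, Finsupp.mapRange_apply, Finsupp.add_apply, Finsupp.single_apply]
  split_ifs <;> simp [hp]

theorem X_mem_degreeLT {d : ℕ} (hd : 1 < d) (i : σ) : (X i : MvPolynomial σ F) ∈ degreeLT σ F d :=
  monomial_mem_degreeLT (by simpa using hd) 1

end

end MvPolynomial

namespace MvPolynomial

variable {σ F : Type*} [Field F]

/-! ### Quotients of `F[σ]` by relations `X i ^ p + (lower degree)` -/

section quotient

variable {p : ℕ} (φ : σ → MvPolynomial σ F)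

/-- Multiplying by `X i ^ p` raises one exponent quotient by one and leaves the remainders alone.
Together with bijectivity, this transports the ideal of the `X i ^ p` onto that of the `φ i`. -/
theorem restrictedExpansion_mul_X_pow (hp : 1 < p) (f : MvPolynomial σ F) (i : σ) :
    restrictedExpansion p φ (f * X i ^ p) = restrictedExpansion p φ f * φ i := by
  induction f using MvPolynomial.induction_on' with
  | add f g hf hg => rw [add_mul, map_add, map_add, add_mul, hf, hg]
  | monomial m c =>
    have e : monomial m c = c • monomial m (1 : F) := by rw [smul_monomial, smul_eq_mul, mul_one]
    rw [e, smul_mul_assoc, map_smul, map_smul, smul_mul_assoc, X_pow_eq_monomial, monomial_mul,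
      mul_one, restrictedExpansion_monomial, restrictedExpansion_monomial, modExp_add_single,
      divExp_add_single (by omega), mul_assoc]
    have e' : monomial (divExp p m + Finsupp.single i 1) (1 : F) =
        monomial (divExp p m) 1 * X i := by
      rw [X, monomial_mul, mul_one]
    rw [e', map_mul, aeval_X]

theorem restrictedExpansion_X (hp : 1 < p) (i : σ) : restrictedExpansion p φ (X i) = X i := by
  have h₁ : modExp p (Finsupp.single i 1) = Finsupp.single i 1 := by
    rw [modExp, Finsupp.mapRange_single, Nat.mod_eq_of_lt hp]
  have h₂ : divExp p (Finsupp.single i 1) = 0 := by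
    rw [divExp, Finsupp.mapRange_single, Nat.div_eq_of_lt hp, Finsupp.single_zero]
  have h := restrictedExpansion_monomial p φ (Finsupp.single i 1)
  rwa [h₁, h₂, monomial_zero', C_1, map_one (aeval φ), mul_one] at h

theorem map_restrictedExpansion (hp : 1 < p) (hφ : ∀ i, φ i - X i ^ p ∈ degreeLT σ F p) :
    ((Ideal.span (Set.range fun i : σ => (X i : MvPolynomial σ F) ^ p)).restrictScalars F).map
      (restrictedExpansion p φ) = (Ideal.span (Set.range φ)).restrictScalars F := by
  apply le_antisymm
  · rintro _ ⟨f, hf, rfl⟩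
    obtain ⟨c, rfl⟩ := Finsupp.mem_ideal_span_range_iff_exists_finsupp.1 hf
    simp only [Finsupp.sum, map_sum, restrictedExpansion_mul_X_pow φ hp]
    exact Submodule.sum_mem _ fun i _ => Ideal.mul_mem_left _ _ (Ideal.subset_span ⟨i, rfl⟩)
  · intro f hf
    obtain ⟨c, rfl⟩ := Finsupp.mem_ideal_span_range_iff_exists_finsupp.1 hf
    refine Submodule.sum_mem _ fun i _ => ?_
    obtain ⟨k, hk⟩ := (restrictedExpansion_bijective hp φ hφ).2 (c i)
    refine ⟨k * X i ^ p, Ideal.mul_mem_left _ _ (Ideal.subset_span ⟨i, rfl⟩), ?_⟩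
    rw [restrictedExpansion_mul_X_pow φ hp, hk]

theorem mem_span_X_pow {f : MvPolynomial σ F} :
    f ∈ Ideal.span (Set.range fun i : σ => (X i : MvPolynomial σ F) ^ p) ↔
      ∀ m ∈ f.support, ∃ i, p ≤ m i := by
  have h : (Set.range fun i : σ => (X i : MvPolynomial σ F) ^ p) =
      (fun s => monomial s (1 : F)) '' Set.range (fun i : σ => Finsupp.single i p) := by
    rw [← Set.range_comp]
    congr 1
    funext i
    exact X_pow_eq_monomial
  rw [h, mem_ideal_span_monomial_image]
  simp

/-- The expansion fixes linear forms, so this reduces to the ideal of the `X i ^ p`, which contains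
no nonzero linear form because `p > 1`. -/
theorem eq_zero_of_linearCombination_X_mem (hp : 1 < p)
    (hφ : ∀ i, φ i - X i ^ p ∈ degreeLT σ F p) {v : σ →₀ F}
    (hv : Finsupp.linearCombination F (X : σ → MvPolynomial σ F) v ∈ Ideal.span (Set.range φ)) :
    v = 0 := by
  classical
  have hT : restrictedExpansion p φ (Finsupp.linearCombination F X v) =
      Finsupp.linearCombination F X v := by
    rw [Finsupp.linearCombination_apply, Finsupp.sum, map_sum]
    exact Finset.sum_congr rfl fun i _ => by rw [map_smul, restrictedExpansion_X φ hp]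
  have hv' : Finsupp.linearCombination F (X : σ → MvPolynomial σ F) v ∈
      (Ideal.span (Set.range φ)).restrictScalars F := hv
  rw [← map_restrictedExpansion φ hp hφ] at hv'
  obtain ⟨f, hf, hf'⟩ := hv'
  obtain rfl := (restrictedExpansion_bijective hp φ hφ).1 (hf'.trans hT.symm)
  have hcoeff : ∀ i, coeff (Finsupp.single i 1)
      (Finsupp.linearCombination F (X : σ → MvPolynomial σ F) v) = v i := by
    intro i
    rw [Finsupp.linearCombination_apply, Finsupp.sum, coeff_sum, Finset.sum_eq_single i]
    · simp
    · intro j _ hj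
      rw [coeff_smul, coeff_X, if_neg, smul_zero]
      exact fun h => hj (Finsupp.single_left_injective one_ne_zero h)
    · intro hi
      rw [Finsupp.notMem_support_iff.1 hi, zero_smul, coeff_zero]
  ext i
  by_contra hi
  obtain ⟨j, hj⟩ := mem_span_X_pow.1 hf (Finsupp.single i 1)
    (mem_support_iff.2 (by rw [hcoeff]; exact hi))
  rw [Finsupp.single_apply] at hj
  split_ifs at hj <;> omega

/-- The expansion reduces to the relations `X i ^ p = 0`, where the coefficients with all exponents
below `p` are coordinates on the quotient. -/
theorem finrank_quotient_span [Finite σ] (hp : 1 < p)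
    (hφ : ∀ i, φ i - X i ^ p ∈ degreeLT σ F p) :
    Module.Finite F (MvPolynomial σ F ⧸ Ideal.span (Set.range φ)) ∧
      Module.finrank F (MvPolynomial σ F ⧸ Ideal.span (Set.range φ)) = p ^ Nat.card σ := by
  classical
  have := Fintype.ofFinite σ
  let I₀ := Ideal.span (Set.range fun i : σ => (X i : MvPolynomial σ F) ^ p)
  let T := LinearEquiv.ofBijective _ (restrictedExpansion_bijective hp φ hφ)
  let e₁ : (MvPolynomial σ F ⧸ I₀.restrictScalars F) ≃ₗ[F]
      (MvPolynomial σ F ⧸ (Ideal.span (Set.range φ)).restrictScalars F) :=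
    Submodule.Quotient.equiv _ _ T (map_restrictedExpansion φ hp hφ)
  let ex : (σ → Fin p) → (σ →₀ ℕ) := fun a => Finsupp.equivFunOnFinite.symm fun i => (a i : ℕ)
  have hex : Function.Injective ex := fun a b h => by
    funext i
    exact Fin.ext (by simpa [ex] using DFunLike.congr_fun h i)
  let c : MvPolynomial σ F →ₗ[F] ((σ → Fin p) → F) := LinearMap.pi fun a => lcoeff F (ex a)
  have hc : ∀ f a, c f a = coeff (ex a) f := fun _ _ => rfl
  have hker : LinearMap.ker c = I₀.restrictScalars F := by
    ext f
    rw [LinearMap.mem_ker, Submodule.restrictScalars_mem, mem_span_X_pow]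
    constructor
    · intro h m hm
      by_contra! hlt
      have h' := congrFun h fun i => ⟨m i, hlt i⟩
      rw [hc, Pi.zero_apply] at h'
      refine mem_support_iff.1 hm ?_
      convert h'
      ext i
      simp [ex]
    · intro h
      funext a
      rw [hc]
      by_contra hne
      obtain ⟨i, hi⟩ := h _ (mem_support_iff.2 hne)
      have := (a i).2
      simp only [ex, Finsupp.equivFunOnFinite_symm_apply_apply] at hi
      omega
  have hsurj : Function.Surjective c := by
    intro g
    refine ⟨∑ a, monomial (ex a) (g a), ?_⟩
    funext b
    rw [hc, coeff_sum, Finset.sum_eq_single b]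
    · simp
    · intro a _ hab
      rw [coeff_monomial, if_neg fun h => hab (hex h)]
    · simp
  let e₂ : (MvPolynomial σ F ⧸ I₀.restrictScalars F) ≃ₗ[F] ((σ → Fin p) → F) :=
    (Submodule.quotEquivOfEq _ _ hker.symm).trans (c.quotKerEquivOfSurjective hsurj)
  let e : ((σ → Fin p) → F) ≃ₗ[F] (MvPolynomial σ F ⧸ Ideal.span (Set.range φ)) :=
    e₂.symm.trans e₁
  refine ⟨Module.Finite.equiv e, ?_⟩
  rw [← e.finrank_eq, Module.finrank_fintype_fun_eq_card]
  simp

end quotient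

/-- The constant and linear part of a polynomial, as an element of a trivial square-zero
extension. -/
noncomputable def firstOrder : MvPolynomial σ F →ₐ[F] TrivSqZeroExt F (σ →₀ F) :=
  aeval fun i => TrivSqZeroExt.inr (Finsupp.single i 1)

theorem firstOrder_linearCombination_X (v : σ →₀ F) :
    firstOrder (Finsupp.linearCombination F (X : σ → MvPolynomial σ F) v) =
      TrivSqZeroExt.inr v := by
  induction v using Finsupp.induction_linear with
  | zero => simp
  | add v w hv hw => rw [map_add, map_add, hv, hw, TrivSqZeroExt.inr_add]
  | single i c =>
    rw [Finsupp.linearCombination_single, map_smul, firstOrder, aeval_X, ← TrivSqZeroExt.inr_smul,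
      Finsupp.smul_single, smul_eq_mul, mul_one]

theorem firstOrder_linearCombination_X_pow {n : ℕ} (hn : 1 < n) (v : σ →₀ F) :
    firstOrder (Finsupp.linearCombination F (X : σ → MvPolynomial σ F) v ^ n) = 0 := by
  obtain ⟨k, rfl⟩ := Nat.exists_eq_add_of_le hn
  rw [map_pow, firstOrder_linearCombination_X, pow_add, Nat.succ_eq_add_one, pow_succ, pow_one,
    TrivSqZeroExt.inr_mul_inr, zero_mul]

theorem linearCombination_X_mem_degreeLT {d : ℕ} (hd : 1 < d) (v : σ →₀ F) :
    Finsupp.linearCombination F (X : σ → MvPolynomial σ F) v ∈ degreeLT σ F d := by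
  rw [Finsupp.linearCombination_apply]
  exact Submodule.sum_mem _ fun i _ => Submodule.smul_mem _ _ (X_mem_degreeLT hd i)

end MvPolynomial

/-! ### The twisted extension of `F[σ]` by `M` -/

open MvPolynomial

/-- The Hochschild extension of the polynomial ring `F[σ]` by the module `M`, on which the
variables act by zero, with cocycle `(f, g) ↦ β (linear part of f) (linear part of g)`. -/
@[nolint unusedArguments]
def CupExtension {σ F M : Type*} [Field F] [AddCommGroup M] [Module F M]
    (_ : (σ →₀ F) →ₗ[F] (σ →₀ F) →ₗ[F] M) : Type _ :=
  MvPolynomial σ F × M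

namespace CupExtension

variable {σ F M : Type*} [Field F] [AddCommGroup M] [Module F M]
  {β : (σ →₀ F) →ₗ[F] (σ →₀ F) →ₗ[F] M}

noncomputable instance : AddCommGroup (CupExtension β) :=
  inferInstanceAs (AddCommGroup (MvPolynomial σ F × M))

noncomputable instance : Module F (CupExtension β) :=
  inferInstanceAs (Module F (MvPolynomial σ F × M))

noncomputable instance : Mul (CupExtension β) where
  mul a b := (a.1 * b.1, (firstOrder a.1).fst • b.2 + (firstOrder b.1).fst • a.2 +
    β (firstOrder a.1).snd (firstOrder b.1).snd)

noncomputable instance : One (CupExtension β) where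
  one := (1, 0)

theorem ext {a b : CupExtension β} (h₁ : a.1 = b.1) (h₂ : a.2 = b.2) : a = b := Prod.ext h₁ h₂

theorem fst_mul (a b : CupExtension β) : (a * b).1 = a.1 * b.1 := rfl

theorem snd_mul (a b : CupExtension β) : (a * b).2 =
    (firstOrder a.1).fst • b.2 + (firstOrder b.1).fst • a.2 +
      β (firstOrder a.1).snd (firstOrder b.1).snd := rfl

theorem fst_one : (1 : CupExtension β).1 = 1 := rfl

theorem snd_one : (1 : CupExtension β).2 = 0 := rfl

theorem fst_add (a b : CupExtension β) : (a + b).1 = a.1 + b.1 := rfl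

theorem snd_add (a b : CupExtension β) : (a + b).2 = a.2 + b.2 := rfl

theorem fst_sub (a b : CupExtension β) : (a - b).1 = a.1 - b.1 := rfl

theorem snd_sub (a b : CupExtension β) : (a - b).2 = a.2 - b.2 := rfl

theorem fst_smul (c : F) (a : CupExtension β) : (c • a).1 = c • a.1 := rfl

theorem snd_smul (c : F) (a : CupExtension β) : (c • a).2 = c • a.2 := rfl

theorem fst_zero : (0 : CupExtension β).1 = 0 := rfl

theorem snd_zero : (0 : CupExtension β).2 = 0 := rfl

/-- Associativity is the Hochschild cocycle identity: the linear part is a derivation at the origin,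
and `β` forms a cup product of two such derivations. -/
noncomputable instance : Ring (CupExtension β) where
  __ := (inferInstance : AddCommGroup (CupExtension β))
  left_distrib a b c := by
    refine ext ?_ ?_
    · simp only [fst_mul, fst_add, mul_add]
    · simp only [snd_mul, snd_add, fst_add, map_add, TrivSqZeroExt.fst_add, TrivSqZeroExt.snd_add]
      module
  right_distrib a b c := by
    refine ext ?_ ?_
    · simp only [fst_mul, fst_add, add_mul]
    · simp only [snd_mul, snd_add, fst_add, map_add, TrivSqZeroExt.fst_add, TrivSqZeroExt.snd_add,
        LinearMap.add_apply]
      module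
  zero_mul a := by
    refine ext ?_ ?_
    · simp only [fst_mul, fst_zero, zero_mul]
    · simp [snd_mul, fst_zero, snd_zero]
  mul_zero a := by
    refine ext ?_ ?_
    · simp only [fst_mul, fst_zero, mul_zero]
    · simp [snd_mul, fst_zero, snd_zero]
  mul_assoc a b c := by
    refine ext ?_ ?_
    · simp only [fst_mul, mul_assoc]
    · simp only [snd_mul, fst_mul, map_mul, TrivSqZeroExt.fst_mul, TrivSqZeroExt.snd_mul,
        map_add, map_smul, LinearMap.add_apply, LinearMap.smul_apply, op_smul_eq_smul]
      module
  one_mul a := by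
    refine ext ?_ ?_
    · simp only [fst_mul, fst_one, one_mul]
    · simp [snd_mul, fst_one, snd_one]
  mul_one a := by
    refine ext ?_ ?_
    · simp only [fst_mul, fst_one, mul_one]
    · simp [snd_mul, fst_one, snd_one]

noncomputable instance : Algebra F (CupExtension β) :=
  Algebra.ofModule
    (fun r a b => by
      refine ext ?_ ?_
      · simp only [fst_mul, fst_smul, smul_mul_assoc]
      · simp only [snd_mul, snd_smul, fst_smul, map_smul, TrivSqZeroExt.fst_smul,
          TrivSqZeroExt.snd_smul, LinearMap.smul_apply, smul_eq_mul]
        module)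
    (fun r a b => by
      refine ext ?_ ?_
      · simp only [fst_mul, fst_smul, mul_smul_comm]
      · simp only [snd_mul, snd_smul, fst_smul, map_smul, TrivSqZeroExt.fst_smul,
          TrivSqZeroExt.snd_smul, smul_eq_mul]
        module)

/-- The projection of the extension onto the polynomial ring. -/
noncomputable def fstHom (β : (σ →₀ F) →ₗ[F] (σ →₀ F) →ₗ[F] M) :
    CupExtension β →ₐ[F] MvPolynomial σ F :=
  AlgHom.ofLinearMap (LinearMap.fst F (MvPolynomial σ F) M) rfl fun _ _ => rfl

theorem fstHom_apply (a : CupExtension β) : fstHom β a = a.1 := rfl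

/-- The linear inclusion of the polynomial ring in the extension. -/
noncomputable def inl (β : (σ →₀ F) →ₗ[F] (σ →₀ F) →ₗ[F] M) :
    MvPolynomial σ F →ₗ[F] CupExtension β :=
  LinearMap.inl F (MvPolynomial σ F) M

/-- The inclusion of the kernel `M` in the extension. -/
noncomputable def inr (β : (σ →₀ F) →ₗ[F] (σ →₀ F) →ₗ[F] M) : M →ₗ[F] CupExtension β :=
  LinearMap.inr F (MvPolynomial σ F) M

theorem fst_inr (m : M) : (inr β m).1 = 0 := rfl

theorem snd_inr (m : M) : (inr β m).2 = m := rfl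

theorem mul_inr (a : CupExtension β) (m : M) : a * inr β m = (firstOrder a.1).fst • inr β m := by
  refine ext ?_ ?_
  · simp [fst_mul, fst_inr, fst_smul]
  · simp [snd_mul, fst_inr, snd_smul, snd_inr]

theorem inr_mul (a : CupExtension β) (m : M) : inr β m * a = (firstOrder a.1).fst • inr β m := by
  refine ext ?_ ?_
  · simp [fst_mul, fst_inr, fst_smul]
  · simp [snd_mul, fst_inr, snd_smul, snd_inr]

section quotient

variable {p : ℕ} (z : σ → CupExtension β)

/-- Lifting the expansion `X ^ (α + p γ) ↦ X ^ α * φ ^ γ` along central lifts of `φ`. -/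
theorem exists_linearMap_lift (hp : 1 < p) (hz : ∀ i a, z i * a = a * z i) :
    ∃ T : MvPolynomial σ F →ₗ[F] CupExtension β,
      (∀ f, (T f).1 = restrictedExpansion p (fun i => (z i).1) f) ∧
      ∀ f i, T (f * X i ^ p) = T f * z i := by
  let zc : σ → Subalgebra.center F (CupExtension β) := fun i =>
    ⟨z i, Subalgebra.mem_center_iff.2 fun a => (hz i a).symm⟩
  let T : MvPolynomial σ F →ₗ[F] CupExtension β := (basisMonomials σ F).constr F fun m =>
    inl β (monomial (modExp p m) 1) * (aeval zc (monomial (divExp p m) (1 : F)) : _)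
  have hT : ∀ m, T (monomial m 1) =
      inl β (monomial (modExp p m) 1) * (aeval zc (monomial (divExp p m) (1 : F)) : _) := by
    intro m
    have h := (basisMonomials σ F).constr_basis F (fun m =>
      inl β (monomial (modExp p m) 1) *
        ((aeval zc (monomial (divExp p m) (1 : F)) : Subalgebra.center F (CupExtension β)) :
          CupExtension β)) m
    rwa [coe_basisMonomials] at h
  have hfst : ((fstHom β).comp (Subalgebra.center F (CupExtension β)).val).comp (aeval zc) =
      aeval fun i => (z i).1 := by
    ext i
    simp [zc, fstHom_apply]
  refine ⟨T, fun f => ?_, fun f i => ?_⟩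
  · have : (fstHom β).toLinearMap ∘ₗ T = restrictedExpansion p (fun i => (z i).1) := by
      refine (basisMonomials σ F).ext fun m => ?_
      rw [coe_basisMonomials, LinearMap.comp_apply, hT, restrictedExpansion_monomial, ← hfst]
      rfl
    exact LinearMap.congr_fun this f
  · induction f using MvPolynomial.induction_on' with
    | add f g hf hg => rw [add_mul, map_add, map_add, add_mul, hf, hg]
    | monomial m c =>
      have e : monomial m c = c • monomial m (1 : F) := by
        rw [smul_monomial, smul_eq_mul, mul_one]
      have e' : monomial (divExp p m + Finsupp.single i 1) (1 : F) =
          monomial (divExp p m) 1 * X i := by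
        rw [X, monomial_mul, mul_one]
      rw [e, smul_mul_assoc, map_smul, map_smul, smul_mul_assoc, X_pow_eq_monomial, monomial_mul,
        mul_one, hT, hT, modExp_add_single, divExp_add_single (by omega), mul_assoc, e', map_mul,
        aeval_X]
      rfl

variable {z}

theorem isTwoSided_span (hz : ∀ i a, z i * a = a * z i) :
    (Ideal.span (Set.range z)).IsTwoSided := by
  refine ⟨fun {a} b ha => ?_⟩
  obtain ⟨c, rfl⟩ := Finsupp.mem_ideal_span_range_iff_exists_finsupp.1 ha
  rw [Finsupp.sum, Finset.sum_mul]
  refine Submodule.sum_mem _ fun i _ => ?_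
  rw [mul_assoc, hz, ← mul_assoc]
  exact Ideal.mul_mem_left _ _ (Ideal.subset_span ⟨i, rfl⟩)

/-- The ideal generated by central elements with first components `X i ^ p + (lower degree)` meets
the kernel of the extension trivially. -/
theorem eq_zero_of_mem_span (hp : 1 < p) (hz : ∀ i a, z i * a = a * z i)
    (hφ : ∀ i, (z i).1 - X i ^ p ∈ degreeLT σ F p) (hz₀ : ∀ i, (firstOrder (z i).1).fst = 0)
    {a : CupExtension β} (ha : a ∈ Ideal.span (Set.range z)) (ha₁ : a.1 = 0) : a = 0 := by
  obtain ⟨T, hT₁, hT⟩ := exists_linearMap_lift z hp hz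
  have hbij := restrictedExpansion_bijective hp _ hφ
  -- The range of `T` contains the whole ideal: any coefficient `c i` differs from some `T k` by an
  -- element of `M`, and `M` is killed by `z i`, whose constant term is zero. Injectivity of the
  -- expansion on first components then finishes.
  have key : ∃ f, T f = a := by
    obtain ⟨c, rfl⟩ := Finsupp.mem_ideal_span_range_iff_exists_finsupp.1 ha
    refine Submodule.sum_mem (LinearMap.range T) fun i _ => ?_
    obtain ⟨k, hk⟩ := hbij.2 (c i).1
    refine ⟨k * X i ^ p, ?_⟩
    have hc : c i = T k + inr β ((c i).2 - (T k).2) := by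
      refine ext ?_ ?_
      · rw [fst_add, fst_inr, hT₁, hk, add_zero]
      · rw [snd_add, snd_inr]; abel
    change _ = c i * z i
    rw [hT, hc, add_mul, inr_mul, hz₀, zero_smul, add_zero]
  obtain ⟨f, rfl⟩ := key
  rw [hT₁] at ha₁
  rw [hbij.1 (ha₁.trans (map_zero _).symm), map_zero]

theorem fst_mem_span {a : CupExtension β} (ha : a ∈ Ideal.span (Set.range z)) :
    a.1 ∈ Ideal.span (Set.range fun i => (z i).1) := by
  obtain ⟨c, rfl⟩ := Finsupp.mem_ideal_span_range_iff_exists_finsupp.1 ha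
  rw [← fstHom_apply, Finsupp.sum, map_sum]
  refine Submodule.sum_mem _ fun i _ => ?_
  rw [map_mul]
  exact Ideal.mul_mem_left _ _ (Ideal.subset_span ⟨i, rfl⟩)

end quotient

end CupExtension

/-- Every alternating bilinear map `A` on a space with a basis is of the form
`A u v = β u v - β v u`. -/
theorem exists_bilin_sub_flip {σ F M : Type*} [Field F] [AddCommGroup M] [Module F M]
    (A : (σ →₀ F) →ₗ[F] (σ →₀ F) →ₗ[F] M) (hA : ∀ u, A u u = 0) :
    ∃ β : (σ →₀ F) →ₗ[F] (σ →₀ F) →ₗ[F] M, ∀ u v, A u v = β u v - β v u := by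
  classical
  have hskew : ∀ u v, A v u = -A u v := by
    intro u v
    have h := hA (u + v)
    simp only [map_add, LinearMap.add_apply, hA, zero_add, add_zero] at h
    exact eq_neg_of_add_eq_zero_left h
  let e := Finsupp.basisSingleOne (R := F) (ι := σ)
  -- The strictly upper triangular half of `A` for a well-ordering of the basis; this avoids
  -- dividing by `2`, so characteristic `2` is covered.
  let β : (σ →₀ F) →ₗ[F] (σ →₀ F) →ₗ[F] M := e.constr F fun i => e.constr F fun j =>
    if WellOrderingRel i j then A (e i) (e j) else 0
  refine ⟨β, fun u v => ?_⟩
  have hβ : ∀ i j, β (e i) (e j) = if WellOrderingRel i j then A (e i) (e j) else 0 := by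
    intro i j
    simp only [β, Module.Basis.constr_basis]
  have h : A = β - β.flip := by
    refine e.ext fun i => e.ext fun j => ?_
    rw [LinearMap.sub_apply, LinearMap.sub_apply, LinearMap.flip_apply, hβ, hβ]
    rcases trichotomous_of WellOrderingRel i j with h | h | h
    · rw [if_pos h, if_neg (asymm h), sub_zero]
    · subst h; rw [hA]; simp
    · rw [if_pos h, if_neg (asymm h), zero_sub, hskew]
  exact congrArg (fun B : (σ →₀ F) →ₗ[F] (σ →₀ F) →ₗ[F] M => B u v) h

namespace CupExtension

variable {σ F M : Type*} [Field F] [AddCommGroup M] [Module F M]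
  {β : (σ →₀ F) →ₗ[F] (σ →₀ F) →ₗ[F] M}

theorem fst_pow (a : CupExtension β) (n : ℕ) : (a ^ n).1 = a.1 ^ n := map_pow (fstHom β) a n

theorem inr_pow (m : M) {n : ℕ} (hn : 2 ≤ n) : inr β m ^ n = 0 := by
  obtain ⟨k, rfl⟩ := Nat.exists_eq_add_of_le' hn
  rw [pow_succ, pow_succ, mul_assoc, mul_inr, fst_inr]
  simp

/-- In `a ^ (n - 1) * a` the left factor has neither constant nor linear part once `n - 1 ≥ 2`, and
`a` has no constant term, so nothing reaches `M`. For squares the term `β v v` would survive. -/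
theorem pow_eq_inl {a : CupExtension β} {v : σ →₀ F} (ha : a.1 = Finsupp.linearCombination F X v)
    {n : ℕ} (hn : 3 ≤ n) : a ^ n = inl β (a.1 ^ n) := by
  obtain ⟨k, rfl⟩ := Nat.exists_eq_add_of_le' hn
  refine ext (fst_pow _ _) ?_
  rw [pow_succ, snd_mul, fst_pow, ha, firstOrder_linearCombination_X_pow (by omega),
    firstOrder_linearCombination_X]
  simp
  rfl

end CupExtension

/-! ### Mapping `L` into the extension -/

namespace RestrictedLieAlgebra

variable {p : ℕ} {F L : Type*} [Field F] [LieRing L] [LieAlgebra F L] [RestrictedLieAlgebra p F L]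
  {σ : Type*}

/-- The relations `X i ^ p = x_i^[p]` of the restricted enveloping algebra of the abelian quotient
`L / L'_p`; here `q` takes coordinates in the quotient and `s` is a section of `q`. -/
noncomputable def abelianRel (p : ℕ) {F L : Type*} [Field F] [LieRing L] [LieAlgebra F L]
    [RestrictedLieAlgebra p F L] {σ : Type*} (q : L →ₗ[F] σ →₀ F) (s : (σ →₀ F) →ₗ[F] L)
    (i : σ) : MvPolynomial σ F :=
  X i ^ p - Finsupp.linearCombination F X (q (pMap p F (s (Finsupp.single i 1))))

theorem abelianRel_sub_mem [Fact p.Prime] (q : L →ₗ[F] σ →₀ F) (s : (σ →₀ F) →ₗ[F] L) (i : σ) :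
    abelianRel p q s i - X i ^ p ∈ degreeLT σ F p := by
  rw [abelianRel, sub_sub_cancel_left]
  exact Submodule.neg_mem _ (linearCombination_X_mem_degreeLT (Fact.out : p.Prime).one_lt _)

theorem firstOrder_abelianRel [Fact p.Prime] (q : L →ₗ[F] σ →₀ F) (s : (σ →₀ F) →ₗ[F] L) (i : σ) :
    firstOrder (abelianRel p q s i) =
      TrivSqZeroExt.inr (-q (pMap p F (s (Finsupp.single i 1)))) := by
  have h := firstOrder_linearCombination_X_pow (F := F) (Fact.out : p.Prime).one_lt
    (Finsupp.single i 1)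
  rw [Finsupp.linearCombination_single, one_smul] at h
  rw [abelianRel, map_sub, h, firstOrder_linearCombination_X, zero_sub, TrivSqZeroExt.inr_neg]

theorem pMap_add_two {L : Type*} [LieRing L] [LieAlgebra F L] [RestrictedLieAlgebra 2 F L]
    (x y : L) : pMap 2 F (x + y) = pMap 2 F x + pMap 2 F y + ⁅y, x⁆ := by
  rw [pMap_add]
  simp [jacobsonCoeff]

/-- The Jacobson corrections are sums of brackets of `p ≥ 3` factors. -/
theorem pMap_add_sub_mem_gammaThree (hp : 3 ≤ p) (x y : L) :
    pMap p F (x + y) - (pMap p F x + pMap p F y) ∈ gammaThree F L := by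
  obtain ⟨n, hn⟩ := Nat.exists_eq_add_of_le' hp
  rw [pMap_add, add_sub_cancel_left]
  refine (gammaThree F L).toSubmodule.sum_mem fun i _ => Submodule.smul_mem _ _ ?_
  rw [hn]
  exact jacobsonCoeff_mem_gammaThree x y n _

section rep

variable {q : L →ₗ[F] σ →₀ F} {s : (σ →₀ F) →ₗ[F] L}

theorem sub_section_mem (hq : LinearMap.ker q = (derivedRestricted p F L).toSubmodule)
    (hs : ∀ v, q (s v) = v) (x : L) : x - s (q x) ∈ derivedRestricted p F L := by
  change _ ∈ (derivedRestricted p F L).toSubmodule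
  rw [← hq, LinearMap.mem_ker, map_sub, hs, sub_self]

/-- There is a bilinear map whose alternation is the bracket modulo `L'^p + γ₃`. -/
theorem exists_bilin_bracket [Fact p.Prime] (hq : LinearMap.ker q = (derivedRestricted p F L).toSubmodule)
    (hs : ∀ v, q (s v) = v) :
    ∃ β : (σ →₀ F) →ₗ[F] (σ →₀ F) →ₗ[F] L ⧸ derivedPowerAddGamma p F L, ∀ x y : L,
      (derivedPowerAddGamma p F L).mkQ ⁅x, y⁆ = β (q x) (q y) - β (q y) (q x) := by
  obtain ⟨β, hβ⟩ := exists_bilin_sub_flip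
    (LinearMap.mk₂ F (fun u v => (derivedPowerAddGamma p F L).mkQ ⁅s u, s v⁆)
      (fun u v w => by simp only [map_add, add_lie]) (fun c u v => by simp only [map_smul, smul_lie])
      (fun u v w => by simp only [map_add, lie_add]) (fun c u v => by simp only [map_smul, lie_smul]))
    (fun u => by simp)
  refine ⟨β, fun x y => ?_⟩
  rw [← hβ, LinearMap.mk₂_apply, ← sub_eq_zero, ← map_sub, Submodule.mkQ_apply,
    Submodule.Quotient.mk_eq_zero]
  -- Replacing `x` and `y` by `s (q x)` and `s (q y)` changes them by elements of `L'_p`, which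
  -- bracket into `γ₃`.
  apply gammaThree_le_derivedPowerAddGamma
  have e : ⁅x, y⁆ - ⁅s (q x), s (q y)⁆ = ⁅x - s (q x), y⁆ - ⁅y - s (q y), s (q x)⁆ := by
    rw [sub_lie, sub_lie, ← lie_skew (s (q x)) y, ← lie_skew (s (q x)) (s (q y))]
    abel
  rw [e]
  exact Submodule.sub_mem _
    (lie_mem_gammaThree_of_mem_derivedRestricted (sub_section_mem hq hs x) _)
    (lie_mem_gammaThree_of_mem_derivedRestricted (sub_section_mem hq hs y) _)

/-- The linear map from `L` to the extension of polynomials in the coordinates of `L / L'_p` by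
`L / (L'^p + γ₃)`. -/
noncomputable def cupMap (p : ℕ) {F L : Type*} [Field F] [LieRing L] [LieAlgebra F L]
    [RestrictedLieAlgebra p F L] {σ : Type*} (q : L →ₗ[F] σ →₀ F) (s : (σ →₀ F) →ₗ[F] L)
    (β : (σ →₀ F) →ₗ[F] (σ →₀ F) →ₗ[F] L ⧸ derivedPowerAddGamma p F L) :
    L →ₗ[F] CupExtension β :=
  CupExtension.inl β ∘ₗ Finsupp.linearCombination F X ∘ₗ q +
    CupExtension.inr β ∘ₗ (derivedPowerAddGamma p F L).mkQ ∘ₗ (LinearMap.id - s ∘ₗ q)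

variable {β : (σ →₀ F) →ₗ[F] (σ →₀ F) →ₗ[F] L ⧸ derivedPowerAddGamma p F L}

theorem fst_cupMap (x : L) :
    (cupMap p q s β x).1 = Finsupp.linearCombination F X (q x) :=
  add_zero _

theorem cupMap_of_mem (hq : LinearMap.ker q = (derivedRestricted p F L).toSubmodule) {x : L}
    (hx : x ∈ derivedRestricted p F L) :
    cupMap p q s β x = CupExtension.inr β ((derivedPowerAddGamma p F L).mkQ x) := by
  have h : q x = 0 := by
    rw [← LinearMap.mem_ker, hq]; exact hx
  simp [cupMap, h]

theorem cupMap_eq_zero (hq : LinearMap.ker q = (derivedRestricted p F L).toSubmodule) {x : L}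
    (hx : x ∈ derivedPowerAddGamma p F L) : cupMap p q s β x = 0 := by
  rw [cupMap_of_mem hq (derivedPowerAddGamma_le hx), Submodule.mkQ_apply,
    (Submodule.Quotient.mk_eq_zero _).2 hx, map_zero]

theorem cupMap_lie (hq : LinearMap.ker q = (derivedRestricted p F L).toSubmodule)
    (hβ : ∀ x y : L,
      (derivedPowerAddGamma p F L).mkQ ⁅x, y⁆ = β (q x) (q y) - β (q y) (q x)) (x y : L) :
    cupMap p q s β ⁅x, y⁆ =
      cupMap p q s β x * cupMap p q s β y - cupMap p q s β y * cupMap p q s β x := by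
  rw [cupMap_of_mem hq (mem_derivedRestricted_of_mem_derivedIdeal (lie_mem_derivedIdeal x y)), hβ]
  refine CupExtension.ext ?_ ?_
  · rw [CupExtension.fst_inr, CupExtension.fst_sub, CupExtension.fst_mul, CupExtension.fst_mul,
      mul_comm, sub_self]
  · rw [CupExtension.snd_inr, CupExtension.snd_sub, CupExtension.snd_mul, CupExtension.snd_mul,
      fst_cupMap, fst_cupMap, firstOrder_linearCombination_X, firstOrder_linearCombination_X]
    simp

/-- The failure of `cupMap` to preserve `p`-th powers. -/
noncomputable def powDefect (p : ℕ) {F L : Type*} [Field F] [LieRing L] [LieAlgebra F L]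
    [RestrictedLieAlgebra p F L] {σ : Type*} (q : L →ₗ[F] σ →₀ F) (s : (σ →₀ F) →ₗ[F] L)
    (β : (σ →₀ F) →ₗ[F] (σ →₀ F) →ₗ[F] L ⧸ derivedPowerAddGamma p F L) (x : L) :
    CupExtension β :=
  cupMap p q s β x ^ p - cupMap p q s β (pMap p F x)

theorem powDefect_smul (c : F) (x : L) :
    powDefect p q s β (c • x) = c ^ p • powDefect p q s β x := by
  rw [powDefect, powDefect, map_smul, smul_pow, pMap_smul, map_smul, smul_sub]

theorem powDefect_of_mem [Fact p.Prime] (hq : LinearMap.ker q = (derivedRestricted p F L).toSubmodule) {x : L}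
    (hx : x ∈ derivedRestricted p F L) : powDefect p q s β x = 0 := by
  rw [powDefect, cupMap_eq_zero hq (pMap_mem_derivedPowerAddGamma hx), sub_zero,
    cupMap_of_mem hq hx, CupExtension.inr_pow _ (Fact.out : p.Prime).two_le]

/-- For `p ≥ 3` the Jacobson corrections vanish in `M` and `p`-th powers depend only on the
commutative first component, so Frobenius is additive. For `p = 2` the cross terms `ab + ba` and the
image `ba - ab` of the correction `[y, x]` differ by `2ab = 0`. -/
theorem powDefect_add [Fact p.Prime] [CharP F p]
    (hq : LinearMap.ker q = (derivedRestricted p F L).toSubmodule)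
    (hβ : ∀ x y : L,
      (derivedPowerAddGamma p F L).mkQ ⁅x, y⁆ = β (q x) (q y) - β (q y) (q x)) (x y : L) :
    powDefect p q s β (x + y) = powDefect p q s β x + powDefect p q s β y := by
  rcases (Fact.out : p.Prime).two_le.eq_or_lt with hp | hp
  · subst hp
    have h2 : ∀ a : CupExtension β, a + a = 0 := fun a => by
      rw [← two_smul F a, show (2 : F) = 0 from CharP.cast_eq_zero F 2, zero_smul]
    rw [powDefect, powDefect, powDefect, pMap_add_two, map_add, map_add, map_add,
      cupMap_lie hq hβ]
    have h := h2 (cupMap 2 q s β x * cupMap 2 q s β y)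
    rw [← sub_eq_zero]
    refine Eq.trans ?_ h
    noncomm_ring
  · have h := cupMap_eq_zero (s := s) (β := β) hq (gammaThree_le_derivedPowerAddGamma
      (pMap_add_sub_mem_gammaThree (F := F) hp x y))
    rw [map_sub, map_add, sub_eq_zero] at h
    rw [powDefect, powDefect, powDefect, h, CupExtension.pow_eq_inl (fst_cupMap _) hp,
      CupExtension.pow_eq_inl (fst_cupMap _) hp, CupExtension.pow_eq_inl (fst_cupMap _) hp,
      map_add, CupExtension.fst_add, add_pow_char, map_add]
    abel

theorem fst_powDefect (hs : ∀ v, q (s v) = v) (i : σ) :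
    (powDefect p q s β (s (Finsupp.single i 1))).1 = abelianRel p q s i := by
  rw [powDefect, CupExtension.fst_sub, CupExtension.fst_pow, fst_cupMap, fst_cupMap, hs,
    Finsupp.linearCombination_single, one_smul, abelianRel]

/-- The first component of the defect has linear part `-q (x^[p])`, so commuting means symmetry of
`β` at that vector, that is, vanishing of `[x^[p], s v]` in `M`. This bracket is `(ad x)^p (s v)`,
which lies in `γ₃` as `p ≥ 2`. -/
theorem powDefect_mul_comm [Fact p.Prime] (hs : ∀ v, q (s v) = v)
    (hβ : ∀ x y : L,
      (derivedPowerAddGamma p F L).mkQ ⁅x, y⁆ = β (q x) (q y) - β (q y) (q x))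
    (i : σ) (a : CupExtension β) :
    powDefect p q s β (s (Finsupp.single i 1)) * a =
      a * powDefect p q s β (s (Finsupp.single i 1)) := by
  refine CupExtension.ext ?_ ?_
  · rw [CupExtension.fst_mul, CupExtension.fst_mul, mul_comm]
  · have h := hβ (pMap p F (s (Finsupp.single i 1))) (s (firstOrder a.1).snd)
    rw [Submodule.mkQ_apply, (Submodule.Quotient.mk_eq_zero _).2
      (gammaThree_le_derivedPowerAddGamma (pMap_lie_mem_gammaThree _ _)), hs] at h
    rw [CupExtension.snd_mul, CupExtension.snd_mul, fst_powDefect hs, firstOrder_abelianRel,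
      TrivSqZeroExt.fst_inr, TrivSqZeroExt.snd_inr, map_neg, map_neg, LinearMap.neg_apply,
      sub_eq_zero.1 h.symm, add_comm (_ • _)]

theorem powDefect_mem_span [Fact p.Prime] [CharP F p]
    (hq : LinearMap.ker q = (derivedRestricted p F L).toSubmodule) (hs : ∀ v, q (s v) = v)
    (hβ : ∀ x y : L,
      (derivedPowerAddGamma p F L).mkQ ⁅x, y⁆ = β (q x) (q y) - β (q y) (q x)) (x : L) :
    powDefect p q s β x ∈
      Ideal.span (Set.range fun i => powDefect p q s β (s (Finsupp.single i 1))) := by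
  have h : ∀ v, powDefect p q s β (s v) ∈
      Ideal.span (Set.range fun i => powDefect p q s β (s (Finsupp.single i 1))) := by
    intro v
    induction v using Finsupp.induction_linear with
    | zero =>
      rw [map_zero, powDefect_of_mem hq (zero_mem _)]
      exact zero_mem _
    | add v w hv hw =>
      rw [map_add, powDefect_add hq hβ]
      exact add_mem hv hw
    | single i c =>
      rw [← mul_one c, ← smul_eq_mul, ← Finsupp.smul_single, map_smul, powDefect_smul,
        Algebra.smul_def]
      exact Ideal.mul_mem_left _ _ (Ideal.subset_span ⟨i, rfl⟩)
  have := powDefect_add hq hβ (s := s) (s (q x)) (x - s (q x))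
  rw [add_sub_cancel, powDefect_of_mem hq (sub_section_mem hq hs x), add_zero] at this
  rw [this]
  exact h _

/-- Both conclusions come from one map of `u(L)` to the extension modulo the defects. Forgetting `M`
gives the commutative quotient; restricting to `L'_p`, which lands in `M`, gives the injectivity
needed for (2). -/
theorem exists_algHom_cupExtension [Fact p.Prime] [CharP F p]
    (hq : LinearMap.ker q = (derivedRestricted p F L).toSubmodule) (hs : ∀ v, q (s v) = v) :
    (∃ g : RestrictedEnveloping p F L →ₐ[F]
        MvPolynomial σ F ⧸ Ideal.span (Set.range (abelianRel p q s)),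
      ∀ x, g (uι p F L x) = Ideal.Quotient.mk _ (Finsupp.linearCombination F X (q x))) ∧
    ∀ x ∈ derivedRestricted p F L, uι p F L x ∈ idealJ p F L → x ∈ derivedPowerAddGamma p F L := by
  obtain ⟨β, hβ⟩ := exists_bilin_bracket hq hs
  let z : σ → CupExtension β := fun i => powDefect p q s β (s (Finsupp.single i 1))
  have hz : ∀ i a, z i * a = a * z i := powDefect_mul_comm hs hβ
  have hz₁ : (fun i => (z i).1) = abelianRel p q s := funext fun i => fst_powDefect hs i
  have hI := CupExtension.isTwoSided_span hz
  let π := Ideal.Quotient.mkₐ F (Ideal.span (Set.range z))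
  have hπ : ∀ a, π a = 0 ↔ a ∈ Ideal.span (Set.range z) := fun a => Ideal.Quotient.eq_zero_iff_mem
  obtain ⟨Ψ, hΨ⟩ := exists_algHom_of_linearMap (p := p) (π.toLinearMap ∘ₗ cupMap p q s β)
    (fun x y => by simp [cupMap_lie hq hβ]) (fun x => by
      have := (hπ _).2 (powDefect_mem_span hq hs hβ x)
      rw [powDefect, map_sub, map_pow, sub_eq_zero] at this
      exact this)
  have hΨ' : ∀ x, Ψ (uι p F L x) = π (cupMap p q s β x) := hΨ
  constructor
  · let θ : CupExtension β ⧸ Ideal.span (Set.range z) →ₐ[F]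
        MvPolynomial σ F ⧸ Ideal.span (Set.range (abelianRel p q s)) :=
      Ideal.Quotient.liftₐ _ ((Ideal.Quotient.mkₐ F _).comp (CupExtension.fstHom β)) (by
        intro a ha
        have := CupExtension.fst_mem_span ha
        rw [hz₁] at this
        exact Ideal.Quotient.eq_zero_iff_mem.2 this)
    refine ⟨θ.comp Ψ, fun x => ?_⟩
    rw [AlgHom.comp_apply, hΨ', ← fst_cupMap (p := p) (s := s) (β := β)]
    rfl
  -- Both actions of `u(L)` on the image of `M` factor through the augmentation, so `ω(L)`
  -- annihilates the image of `L'` from either side.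
  · have haug : ∀ (m) (a : RestrictedEnveloping p F L),
        Ψ a * π (CupExtension.inr β m) = augmentation p F L a • π (CupExtension.inr β m) ∧
        π (CupExtension.inr β m) * Ψ a = augmentation p F L a • π (CupExtension.inr β m) := by
      intro m a
      induction a using restrictedEnveloping_induction with
      | algebraMap c =>
        rw [AlgHom.commutes, AlgHom.commutes, Algebra.smul_def, Algebra.algebraMap_self_apply]
        exact ⟨rfl, (Algebra.commutes _ _).symm⟩
      | ι x =>
        rw [hΨ', augmentation_uι, zero_smul, ← map_mul, ← map_mul, CupExtension.mul_inr,
          CupExtension.inr_mul, fst_cupMap, firstOrder_linearCombination_X]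
        simp
      | add a b ha hb => simp only [map_add, add_mul, mul_add, add_smul, ha, hb, and_self]
      | mul a b ha hb =>
        constructor
        · rw [map_mul, map_mul, mul_assoc, hb.1, mul_smul_comm, ha.1, smul_smul, mul_comm]
        · rw [map_mul, map_mul, ← mul_assoc, ha.2, smul_mul_assoc, hb.2, smul_smul]
    have hJ : idealJ p F L ≤ LinearMap.ker Ψ.toLinearMap := by
      refine sup_le (Submodule.mul_le.2 ?_) (Submodule.mul_le.2 ?_)
      · rintro a ha _ ⟨l, hl, rfl⟩
        have ha' : augmentation p F L a = 0 := ha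
        rw [LinearMap.mem_ker, AlgHom.toLinearMap_apply, map_mul, hΨ',
          cupMap_of_mem hq (mem_derivedRestricted_of_mem_derivedIdeal hl), (haug _ _).1, ha',
          zero_smul]
      · rintro _ ⟨l, hl, rfl⟩ a ha
        have ha' : augmentation p F L a = 0 := ha
        rw [LinearMap.mem_ker, AlgHom.toLinearMap_apply, map_mul, hΨ',
          cupMap_of_mem hq (mem_derivedRestricted_of_mem_derivedIdeal hl), (haug _ _).2, ha',
          zero_smul]
    intro x hx hxJ
    have h : π (cupMap p q s β x) = 0 := by rw [← hΨ']; exact hJ hxJ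
    rw [cupMap_of_mem hq hx, hπ] at h
    have hφ : ∀ i, (z i).1 - X i ^ p ∈ degreeLT σ F p := fun i => by
      rw [show (z i).1 = _ from fst_powDefect hs i]
      exact abelianRel_sub_mem q s i
    have hz₀ : ∀ i, (firstOrder (z i).1).fst = 0 := fun i => by
      rw [show (z i).1 = _ from fst_powDefect hs i, firstOrder_abelianRel, TrivSqZeroExt.fst_inr]
    have h' := CupExtension.eq_zero_of_mem_span (Fact.out : p.Prime).one_lt hz hφ hz₀ h
      (CupExtension.fst_inr _)
    have h'' := congrArg Prod.snd h'
    exact (Submodule.Quotient.mk_eq_zero _).1 h''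

end rep

end RestrictedLieAlgebra

namespace RestrictedLieAlgebra

/-! ### The ideals `L'_p u(L)` and `J_L`, and the isomorphism (2) -/

section ideals

variable {p : ℕ} {F L : Type*} [Field F] [LieRing L] [LieAlgebra F L] [RestrictedLieAlgebra p F L]

/-- The image of `L'` in `u(L)`. -/
noncomputable def derivedImage (p : ℕ) (F L : Type*) [Field F] [LieRing L] [LieAlgebra F L]
    [RestrictedLieAlgebra p F L] : Submodule F (RestrictedEnveloping p F L) :=
  (derivedIdeal F L).toSubmodule.map (uι p F L)

theorem uι_mem_derivedImage {x : L} (hx : x ∈ derivedIdeal F L) :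
    uι p F L x ∈ derivedImage p F L :=
  Submodule.mem_map_of_mem hx

/-- On generators this is `x l = [x, l] + l x` with `[x, l] ∈ L'`. -/
theorem mul_mem_derivedImage_mul_top (a : RestrictedEnveloping p F L) :
    ∀ y ∈ derivedImage p F L * ⊤, a * y ∈ derivedImage p F L * ⊤ := by
  induction a using restrictedEnveloping_induction with
  | algebraMap c =>
    intro y hy
    rw [← Algebra.smul_def]
    exact Submodule.smul_mem _ _ hy
  | ι x =>
    intro y hy
    induction hy using Submodule.mul_induction_on' with
    | mem_mul_mem n hn b _ =>
      obtain ⟨l, hl, rfl⟩ := hn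
      have h := uι_lie (p := p) (F := F) x l
      rw [eq_sub_iff_add_eq] at h
      rw [← mul_assoc, ← h, add_mul, mul_assoc]
      exact Submodule.add_mem _
        (Submodule.mul_mem_mul (uι_mem_derivedImage (lie_mem_derivedIdeal x l)) Submodule.mem_top)
        (Submodule.mul_mem_mul (uι_mem_derivedImage hl) Submodule.mem_top)
    | add a _ b _ ha hb => rw [mul_add]; exact Submodule.add_mem _ ha hb
  | add a b ha hb => intro y hy; rw [add_mul]; exact Submodule.add_mem _ (ha y hy) (hb y hy)
  | mul a b ha hb => intro y hy; rw [mul_assoc]; exact ha _ (hb y hy)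

theorem mul_mem_top_mul_derivedImage (a : RestrictedEnveloping p F L) :
    ∀ y ∈ ⊤ * derivedImage p F L, y * a ∈ ⊤ * derivedImage p F L := by
  induction a using restrictedEnveloping_induction with
  | algebraMap c =>
    intro y hy
    rw [← Algebra.commutes, ← Algebra.smul_def]
    exact Submodule.smul_mem _ _ hy
  | ι x =>
    intro y hy
    induction hy using Submodule.mul_induction_on' with
    | mem_mul_mem b _ n hn =>
      obtain ⟨l, hl, rfl⟩ := hn
      have h := uι_lie (p := p) (F := F) l x
      rw [eq_sub_iff_add_eq] at h
      rw [mul_assoc, ← h, mul_add, ← mul_assoc b]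
      exact Submodule.add_mem _
        (Submodule.mul_mem_mul Submodule.mem_top (uι_mem_derivedImage (lie_mem_derivedIdeal l x)))
        (Submodule.mul_mem_mul Submodule.mem_top (uι_mem_derivedImage hl))
    | add a _ b _ ha hb => rw [add_mul]; exact Submodule.add_mem _ ha hb
  | add a b ha hb => intro y hy; rw [mul_add]; exact Submodule.add_mem _ (ha y hy) (hb y hy)
  | mul a b ha hb => intro y hy; rw [← mul_assoc]; exact hb _ (ha y hy)

theorem top_mul_derivedImage :
    ⊤ * derivedImage p F L = derivedImage p F L * ⊤ := by
  apply le_antisymm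
  · refine Submodule.mul_le.2 fun a _ n hn => mul_mem_derivedImage_mul_top a n ?_
    rw [← mul_one n]
    exact Submodule.mul_mem_mul hn Submodule.mem_top
  · refine Submodule.mul_le.2 fun n hn a _ => mul_mem_top_mul_derivedImage a n ?_
    rw [← one_mul n]
    exact Submodule.mul_mem_mul Submodule.mem_top hn

theorem top_mul_top {U : Type*} [Ring U] [Algebra F U] : (⊤ : Submodule F U) * ⊤ = ⊤ :=
  eq_top_iff.2 fun a _ => by
    rw [← mul_one a]
    exact Submodule.mul_mem_mul Submodule.mem_top Submodule.mem_top

theorem derivedImage_mul_top_mul_mem :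
    ∀ y ∈ derivedImage p F L * ⊤, ∀ b, y * b ∈ derivedImage p F L * ⊤ := by
  intro y hy b
  have := Submodule.mul_mem_mul hy (Submodule.mem_top (x := b) (R := F))
  rwa [mul_assoc, top_mul_top] at this

/-- The elements of `L` with image in the right ideal `L' u(L)` form a restricted subalgebra, since
`x^[p] = x · x^(p-1)` in `u(L)`. -/
theorem derivedMulU_eq [Fact p.Prime] : derivedMulU p F L = derivedImage p F L * ⊤ := by
  have hr := derivedImage_mul_top_mul_mem (p := p) (F := F) (L := L)
  apply le_antisymm
  · refine Submodule.mul_le.2 ?_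
    rintro _ ⟨x, hx, rfl⟩ b -
    refine hr _ ?_ b
    let K : LieSubalgebra F L :=
      { (derivedImage p F L * ⊤).comap (uι p F L) with
        lie_mem' := fun {a b} ha hb => by
          change uι p F L ⁅a, b⁆ ∈ derivedImage p F L * ⊤
          rw [uι_lie]
          exact Submodule.sub_mem _ (hr _ ha _) (hr _ hb _) }
    refine mem_restrictedClosure.1 hx K ?_ ?_
    · intro l hl
      change uι p F L l ∈ derivedImage p F L * ⊤
      rw [← mul_one (uι p F L l)]
      exact Submodule.mul_mem_mul (uι_mem_derivedImage hl) Submodule.mem_top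
    · intro l hl
      change uι p F L (pMap p F l) ∈ derivedImage p F L * ⊤
      rw [← uι_pow]
      rw [← mul_pow_sub_one (Fact.out : p.Prime).ne_zero]
      exact hr _ hl _
  · refine mul_le_mul' (Submodule.map_mono fun x hx => ?_) le_rfl
    exact mem_derivedRestricted_of_mem_derivedIdeal hx

/-- The span of all commutators of an algebra. -/
def commutatorSpan (F U : Type*) [Field F] [Ring U] [Algebra F U] : Submodule F U :=
  Submodule.span F {c | ∃ a b : U, a * b - b * a = c}

/-- This description uses only the ring structure, so isomorphisms preserve it. Commuting with a
fixed element is a derivation, so modulo the two-sided ideal `L' u(L)` commutators need only be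
checked on generators. -/
theorem derivedMulU_eq_commutatorSpan_mul [Fact p.Prime] :
    derivedMulU p F L = commutatorSpan F (RestrictedEnveloping p F L) * ⊤ := by
  rw [derivedMulU_eq]
  have hl := mul_mem_derivedImage_mul_top (p := p) (F := F) (L := L)
  have hr := derivedImage_mul_top_mul_mem (p := p) (F := F) (L := L)
  apply le_antisymm
  · refine mul_le_mul' (Submodule.map_le_iff_le_comap.2 ?_) le_rfl
    refine derivedIdeal_le_span.trans (Submodule.span_le.2 ?_)
    rintro _ ⟨x, y, rfl⟩
    change uι p F L ⁅x, y⁆ ∈ commutatorSpan F (RestrictedEnveloping p F L)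
    rw [uι_lie]
    exact Submodule.subset_span ⟨_, _, rfl⟩
  · have hmul : ∀ a b c : RestrictedEnveloping p F L,
        a * c - c * a ∈ derivedImage p F L * ⊤ → b * c - c * b ∈ derivedImage p F L * ⊤ →
        a * b * c - c * (a * b) ∈ derivedImage p F L * ⊤ := by
      intro a b c ha hb
      have e : a * b * c - c * (a * b) = a * (b * c - c * b) + (a * c - c * a) * b := by
        noncomm_ring
      rw [e]
      exact Submodule.add_mem _ (hl _ _ hb) (hr _ ha _)
    have hadd : ∀ a b c : RestrictedEnveloping p F L,
        a * c - c * a ∈ derivedImage p F L * ⊤ → b * c - c * b ∈ derivedImage p F L * ⊤ →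
        (a + b) * c - c * (a + b) ∈ derivedImage p F L * ⊤ := by
      intro a b c ha hb
      have e : (a + b) * c - c * (a + b) = (a * c - c * a) + (b * c - c * b) := by noncomm_ring
      rw [e]
      exact Submodule.add_mem _ ha hb
    have hcomm : ∀ a b : RestrictedEnveloping p F L, a * b - b * a ∈ derivedImage p F L * ⊤ := by
      intro a b
      induction a using restrictedEnveloping_induction with
      | algebraMap c => rw [Algebra.commutes, sub_self]; exact zero_mem _
      | add a a' ha ha' => exact hadd _ _ _ ha ha'
      | mul a a' ha ha' => exact hmul _ _ _ ha ha'
      | ι x =>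
        rw [← neg_mem_iff, neg_sub]
        induction b using restrictedEnveloping_induction with
        | algebraMap c => rw [Algebra.commutes, sub_self]; exact zero_mem _
        | add a a' ha ha' => exact hadd _ _ _ ha ha'
        | mul a a' ha ha' => exact hmul _ _ _ ha ha'
        | ι y =>
          rw [← uι_lie, ← mul_one (uι p F L _)]
          exact Submodule.mul_mem_mul (uι_mem_derivedImage (lie_mem_derivedIdeal y x))
            Submodule.mem_top
    refine Submodule.mul_le.2 fun a ha b _ => hr _ ?_ b
    refine (Submodule.span_le (p := derivedImage p F L * ⊤)).2 ?_ ha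
    rintro _ ⟨a, b, rfl⟩
    exact hcomm a b

variable [Fact p.Prime]

theorem mem_augmentationIdeal {a : RestrictedEnveloping p F L} :
    a ∈ augmentationIdeal p F L ↔ augmentation p F L a = 0 := Iff.rfl

theorem uι_mem_augmentationIdeal (x : L) : uι p F L x ∈ augmentationIdeal p F L :=
  augmentation_uι x

theorem top_mul_augmentationIdeal : ⊤ * augmentationIdeal p F L = augmentationIdeal p F L := by
  apply le_antisymm
  · refine Submodule.mul_le.2 fun a _ b hb => ?_
    rw [mem_augmentationIdeal] at hb ⊢
    rw [map_mul, hb, mul_zero]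
  · intro a ha
    rw [← one_mul a]
    exact Submodule.mul_mem_mul Submodule.mem_top ha

theorem augmentationIdeal_mul_top : augmentationIdeal p F L * ⊤ = augmentationIdeal p F L := by
  apply le_antisymm
  · refine Submodule.mul_le.2 fun a ha b _ => ?_
    rw [mem_augmentationIdeal] at ha ⊢
    rw [map_mul, ha, zero_mul]
  · intro a ha
    rw [← mul_one a]
    exact Submodule.mul_mem_mul ha Submodule.mem_top

/-- Because `L' u(L) = u(L) L'`, the factor `u(L)` can be moved next to `ω(L)` and absorbed. This
expresses `J_L` through ideals that can be transported along an isomorphism. -/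
theorem idealJ_eq : idealJ p F L =
    augmentationIdeal p F L * derivedMulU p F L ⊔ derivedMulU p F L * augmentationIdeal p F L := by
  have h₁ : augmentationIdeal p F L * derivedMulU p F L =
      augmentationIdeal p F L * derivedImage p F L := by
    rw [derivedMulU_eq, ← top_mul_derivedImage, ← mul_assoc, augmentationIdeal_mul_top]
  have h₂ : derivedMulU p F L * augmentationIdeal p F L =
      derivedImage p F L * augmentationIdeal p F L := by
    rw [derivedMulU_eq, mul_assoc, top_mul_augmentationIdeal]
  rw [h₁, h₂]
  rfl

theorem derivedMulU_mul_top : derivedMulU p F L * ⊤ = derivedMulU p F L := by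
  rw [derivedMulU_eq, mul_assoc, top_mul_top]

theorem mul_mem_idealJ {a : RestrictedEnveloping p F L} (ha : a ∈ idealJ p F L)
    (b : RestrictedEnveloping p F L) : a * b ∈ idealJ p F L := by
  have h := Submodule.mul_mem_mul ha (Submodule.mem_top (x := b) (R := F))
  rwa [idealJ_eq, Submodule.sup_mul, mul_assoc, mul_assoc, derivedMulU_mul_top,
    augmentationIdeal_mul_top, ← idealJ_eq] at h

/-- For `l ∈ L'`, `l^[p] = l · l^(p-1)` with `l^(p-1) ∈ ω(L)`, and `[a, l] = a l - l a`. As `J_L` is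
a right ideal, its preimage in `L` is a restricted subalgebra, so all of `L'^p` is reached. -/
theorem uι_mem_idealJ {x : L} (hx : x ∈ derivedPowerAddGamma p F L) :
    uι p F L x ∈ idealJ p F L := by
  have hl : ∀ l ∈ derivedIdeal F L, ∀ a ∈ augmentationIdeal p F L,
      uι p F L l * a ∈ idealJ p F L := fun l hl a ha =>
    (le_sup_right : _ ≤ idealJ p F L) (Submodule.mul_mem_mul (uι_mem_derivedImage hl) ha)
  have hr : ∀ l ∈ derivedIdeal F L, ∀ a ∈ augmentationIdeal p F L,
      a * uι p F L l ∈ idealJ p F L := fun l hl a ha =>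
    (le_sup_left : _ ≤ idealJ p F L) (Submodule.mul_mem_mul ha (uι_mem_derivedImage hl))
  refine (sup_le ?_ ?_ : derivedPowerAddGamma p F L ≤ (idealJ p F L).comap (uι p F L)) hx
  · intro y hy
    let K : LieSubalgebra F L :=
      { (idealJ p F L).comap (uι p F L) with
        lie_mem' := fun {a b} ha hb => by
          change uι p F L ⁅a, b⁆ ∈ idealJ p F L
          rw [uι_lie]
          exact Submodule.sub_mem _ (mul_mem_idealJ ha _) (mul_mem_idealJ hb _) }
    refine mem_restrictedClosure.1 hy K ?_ ?_
    · rintro _ ⟨l, hl', rfl⟩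
      change uι p F L (pMap p F l) ∈ idealJ p F L
      obtain ⟨n, hn⟩ := Nat.exists_eq_add_of_le' (Fact.out : p.Prime).two_le
      rw [← uι_pow, ← mul_pow_sub_one (Fact.out : p.Prime).ne_zero]
      refine hl l hl' _ ?_
      rw [mem_augmentationIdeal, map_pow, augmentation_uι, zero_pow]
      omega
    · intro l hl'
      change uι p F L (pMap p F l) ∈ idealJ p F L
      rw [← uι_pow, ← mul_pow_sub_one (Fact.out : p.Prime).ne_zero]
      exact mul_mem_idealJ hl' _
  · refine gammaThree_le fun a l hl' => ?_
    rw [Submodule.mem_comap, uι_lie]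
    exact Submodule.sub_mem _ (hr l hl' _ (uι_mem_augmentationIdeal a))
      (hl l hl' _ (uι_mem_augmentationIdeal a))

/-- Splitting the right factor into its augmentation and a remainder in `ω(L)` shows that `L'`
already represents every class modulo `J_L`. -/
theorem derivedMulU_le : derivedMulU p F L ≤ derivedImage p F L ⊔ idealJ p F L := by
  rw [derivedMulU_eq]
  refine Submodule.mul_le.2 fun n hn a _ => ?_
  have ha : a - algebraMap F _ (augmentation p F L a) ∈ augmentationIdeal p F L := by
    rw [mem_augmentationIdeal, map_sub, AlgHom.commutes, Algebra.algebraMap_self_apply, sub_self]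
  have e : n * a = augmentation p F L a • n + n * (a - algebraMap F _ (augmentation p F L a)) := by
    rw [mul_sub, ← Algebra.commutes, ← Algebra.smul_def, add_sub_cancel]
  rw [e]
  exact Submodule.add_mem_sup (Submodule.smul_mem _ _ hn)
    ((le_sup_right : _ ≤ idealJ p F L) (Submodule.mul_mem_mul hn ha))

/-- Coordinates on `L / L'_p` together with a section. -/
theorem exists_section.{u, v} (p : ℕ) (F : Type u) (L : Type v) [Field F] [LieRing L] [LieAlgebra F L]
    [RestrictedLieAlgebra p F L] :
    ∃ (σ : Type v) (q : L →ₗ[F] σ →₀ F) (s : (σ →₀ F) →ₗ[F] L),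
      LinearMap.ker q = (derivedRestricted p F L).toSubmodule ∧ ∀ v, q (s v) = v := by
  let b := Module.Basis.ofVectorSpace F (L ⧸ (derivedRestricted p F L).toSubmodule)
  let q := b.repr.toLinearMap ∘ₗ (derivedRestricted p F L).toSubmodule.mkQ
  have hq : LinearMap.range q = ⊤ := by
    rw [LinearMap.range_eq_top]
    exact b.repr.surjective.comp (Submodule.mkQ_surjective _)
  obtain ⟨s, hs⟩ := q.exists_rightInverse_of_surjective hq
  refine ⟨_, q, s, ?_, fun v => LinearMap.congr_fun hs v⟩
  rw [LinearEquiv.ker_comp, Submodule.ker_mkQ]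

/-- The isomorphism `L'_p / (L'^p + γ₃) ≃ L'_p u(L) / J_L`, for any restricted Lie algebra. -/
theorem exists_equiv_derivedMulU_quotient [CharP F p] :
    ∃ e : ((derivedRestricted p F L).toSubmodule ⧸
          (derivedPowerAddGamma p F L).submoduleOf (derivedRestricted p F L).toSubmodule) ≃ₗ[F]
        (derivedMulU p F L ⧸ (idealJ p F L).submoduleOf (derivedMulU p F L)),
      ∀ x : (derivedRestricted p F L).toSubmodule,
        e (Submodule.Quotient.mk x) =
          Submodule.Quotient.mk ⟨uι p F L x, uι_mem_derivedMulU p F L x⟩ := by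
  let f : (derivedRestricted p F L).toSubmodule →ₗ[F]
      (derivedMulU p F L ⧸ (idealJ p F L).submoduleOf (derivedMulU p F L)) :=
    Submodule.mkQ _ ∘ₗ ((uι p F L) ∘ₗ (derivedRestricted p F L).toSubmodule.subtype).codRestrict
      (derivedMulU p F L) (uι_mem_derivedMulU p F L)
  have hf : ∀ x, f x = Submodule.Quotient.mk ⟨uι p F L x, uι_mem_derivedMulU p F L x⟩ :=
    fun _ => rfl
  have hker : LinearMap.ker f =
      (derivedPowerAddGamma p F L).submoduleOf (derivedRestricted p F L).toSubmodule := by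
    ext x
    rw [LinearMap.mem_ker, hf, Submodule.Quotient.mk_eq_zero]
    change uι p F L x ∈ idealJ p F L ↔ (x : L) ∈ derivedPowerAddGamma p F L
    obtain ⟨σ, q, s, hq, hs⟩ := exists_section p F L
    exact ⟨(exists_algHom_cupExtension hq hs).2 _ x.2, uι_mem_idealJ⟩
  have hsurj : Function.Surjective f := by
    intro y
    obtain ⟨⟨y, hy⟩, rfl⟩ := Submodule.Quotient.mk_surjective _ y
    obtain ⟨_, ⟨l, hl, rfl⟩, j, hj, rfl⟩ := Submodule.mem_sup.1 (derivedMulU_le hy)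
    refine ⟨⟨l, mem_derivedRestricted_of_mem_derivedIdeal hl⟩, ?_⟩
    rw [hf, Submodule.Quotient.eq]
    change uι p F L l - (uι p F L l + j) ∈ idealJ p F L
    rw [sub_add_cancel_left]
    exact Submodule.neg_mem _ hj
  refine ⟨(Submodule.quotEquivOfEq _ _ hker.symm).trans (f.quotKerEquivOfSurjective hsurj),
    fun x => ?_⟩
  rw [← hf]
  rfl

end ideals

end RestrictedLieAlgebra

namespace RestrictedLieAlgebra

/-! ### Invariance under isomorphisms of enveloping algebras -/

section universal

variable {p : ℕ} {F L : Type*} [Field F] [LieRing L] [LieAlgebra F L]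
  [RestrictedLieAlgebra p F L] {σ : Type*} {q : L →ₗ[F] σ →₀ F} {s : (σ →₀ F) →ₗ[F] L}

theorem algHom_uι_eq_zero [Fact p.Prime] {S : Type*} [CommRing S] [Algebra F S]
    (h : RestrictedEnveloping p F L →ₐ[F] S) {x : L} (hx : x ∈ derivedRestricted p F L) :
    h (uι p F L x) = 0 := by
  have hlie : ∀ x y : L, h (uι p F L ⁅x, y⁆) = 0 := fun x y => by
    rw [uι_lie, map_sub, map_mul, map_mul, mul_comm, sub_self]
  let K : LieSubalgebra F L :=
    { LinearMap.ker (h.toLinearMap ∘ₗ uι p F L) with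
      lie_mem' := fun {a b} _ _ => hlie a b }
  refine mem_restrictedClosure.1 hx K ?_ ?_
  · refine derivedIdeal_le_span.trans (Submodule.span_le.2 ?_)
    rintro _ ⟨x, y, rfl⟩
    exact hlie x y
  · intro a ha
    have ha' : h (uι p F L a) = 0 := ha
    change h (uι p F L (pMap p F a)) = 0
    rw [← uι_pow, map_pow, ha', zero_pow (Fact.out : p.Prime).ne_zero]

/-- Algebra maps from `u(L)` to commutative algebras factor through the restricted enveloping
algebra of `L / L'_p`. -/
theorem exists_algHom_factor [Fact p.Prime] (hq : LinearMap.ker q = (derivedRestricted p F L).toSubmodule)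
    (hs : ∀ v, q (s v) = v) {S : Type*} [CommRing S] [Algebra F S]
    (h : RestrictedEnveloping p F L →ₐ[F] S) :
    ∃ h' : (MvPolynomial σ F ⧸ Ideal.span (Set.range (abelianRel p q s))) →ₐ[F] S,
      ∀ x, h' (Ideal.Quotient.mk _ (Finsupp.linearCombination F X (q x))) = h (uι p F L x) := by
  let f : MvPolynomial σ F →ₐ[F] S := aeval fun i => h (uι p F L (s (Finsupp.single i 1)))
  have hf' : ∀ v, f (Finsupp.linearCombination F X v) = h (uι p F L (s v)) := by
    intro v
    induction v using Finsupp.induction_linear with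
    | zero => simp
    | add v w hv hw => simp only [map_add, hv, hw]
    | single i c =>
      rw [Finsupp.linearCombination_single, map_smul, aeval_X, ← map_smul, ← map_smul, ← map_smul,
        Finsupp.smul_single, smul_eq_mul, mul_one]
  have hf : ∀ x, f (Finsupp.linearCombination F X (q x)) = h (uι p F L x) := by
    intro x
    rw [hf', ← sub_eq_zero, ← map_sub, ← map_sub, ← neg_sub, map_neg, map_neg,
      algHom_uι_eq_zero h (sub_section_mem hq hs x), neg_zero]
  refine ⟨Ideal.Quotient.liftₐ _ f fun a ha => ?_, hf⟩
  have hle : Ideal.span (Set.range (abelianRel p q s)) ≤ RingHom.ker f := by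
    refine Ideal.span_le.2 ?_
    rintro _ ⟨i, rfl⟩
    change f (abelianRel p q s i) = 0
    rw [abelianRel, map_sub, map_pow, aeval_X, hf, ← map_pow, uι_pow, sub_self]
  exact hle ha

theorem abelianQuotient_hom_ext (hs : ∀ v, q (s v) = v) {S : Type*} [CommRing S] [Algebra F S]
    {f g : (MvPolynomial σ F ⧸ Ideal.span (Set.range (abelianRel p q s))) →ₐ[F] S}
    (h : ∀ x, f (Ideal.Quotient.mk _ (Finsupp.linearCombination F X (q x))) =
      g (Ideal.Quotient.mk _ (Finsupp.linearCombination F X (q x)))) : f = g := by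
  refine Ideal.Quotient.algHom_ext F (MvPolynomial.algHom_ext fun i => ?_)
  have := h (s (Finsupp.single i 1))
  rw [hs, Finsupp.linearCombination_single, one_smul] at this
  exact this

/-- Each side is the universal commutative quotient of its enveloping algebra, so `e` induces
mutually inverse maps. -/
theorem nonempty_abelianQuotient_equiv [Fact p.Prime] [CharP F p]
    (hq : LinearMap.ker q = (derivedRestricted p F L).toSubmodule) (hs : ∀ v, q (s v) = v)
    {H : Type*} [LieRing H] [LieAlgebra F H] [RestrictedLieAlgebra p F H]
    {τ : Type*} {q' : H →ₗ[F] τ →₀ F} {s' : (τ →₀ F) →ₗ[F] H}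
    (hq' : LinearMap.ker q' = (derivedRestricted p F H).toSubmodule) (hs' : ∀ v, q' (s' v) = v)
    (e : RestrictedEnveloping p F L ≃ₐ[F] RestrictedEnveloping p F H) :
    Nonempty ((MvPolynomial σ F ⧸ Ideal.span (Set.range (abelianRel p q s))) ≃ₐ[F]
      (MvPolynomial τ F ⧸ Ideal.span (Set.range (abelianRel p q' s')))) := by
  obtain ⟨g, hg⟩ := (exists_algHom_cupExtension hq hs).1
  obtain ⟨g', hg'⟩ := (exists_algHom_cupExtension hq' hs').1
  obtain ⟨a, ha⟩ := exists_algHom_factor hq hs (g'.comp e.toAlgHom)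
  obtain ⟨b, hb⟩ := exists_algHom_factor hq' hs' (g.comp e.symm.toAlgHom)
  have hag : a.comp g = g'.comp e.toAlgHom :=
    restrictedEnveloping_hom_ext fun x => by rw [AlgHom.comp_apply, hg, ha]
  have hbg : b.comp g' = g.comp e.symm.toAlgHom :=
    restrictedEnveloping_hom_ext fun x => by rw [AlgHom.comp_apply, hg', hb]
  have hag' : ∀ u, a (g u) = g' (e u) := fun u => DFunLike.congr_fun hag u
  have hbg' : ∀ u, b (g' u) = g (e.symm u) := fun u => DFunLike.congr_fun hbg u
  refine ⟨AlgEquiv.ofAlgHom a b ?_ ?_⟩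
  · refine abelianQuotient_hom_ext hs' fun x => ?_
    rw [← hg', AlgHom.comp_apply, hbg', hag', AlgEquiv.apply_symm_apply, AlgHom.id_apply]
  · refine abelianQuotient_hom_ext hs fun x => ?_
    rw [← hg, AlgHom.comp_apply, hag', hbg', AlgEquiv.symm_apply_apply, AlgHom.id_apply]

theorem finrank_quotient_derivedRestricted
    (hq : LinearMap.ker q = (derivedRestricted p F L).toSubmodule) (hs : ∀ v, q (s v) = v)
    [Finite σ] :
    FiniteDimensional F (L ⧸ (derivedRestricted p F L).toSubmodule) ∧
      Module.finrank F (L ⧸ (derivedRestricted p F L).toSubmodule) = Nat.card σ := by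
  have := Fintype.ofFinite σ
  let e : (L ⧸ (derivedRestricted p F L).toSubmodule) ≃ₗ[F] (σ →₀ F) :=
    (Submodule.quotEquivOfEq _ _ hq.symm).trans
      (q.quotKerEquivOfSurjective fun v => ⟨s v, hs v⟩)
  refine ⟨Module.Finite.equiv e.symm, ?_⟩
  rw [e.finrank_eq, Module.finrank_finsupp_self, Nat.card_eq_fintype_card]

theorem finite_of_quotient_derivedRestricted
    (hq : LinearMap.ker q = (derivedRestricted p F L).toSubmodule) (hs : ∀ v, q (s v) = v)
    [FiniteDimensional F (L ⧸ (derivedRestricted p F L).toSubmodule)] : Finite σ := by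
  let e : (L ⧸ (derivedRestricted p F L).toSubmodule) ≃ₗ[F] (σ →₀ F) :=
    (Submodule.quotEquivOfEq _ _ hq.symm).trans
      (q.quotKerEquivOfSurjective fun v => ⟨s v, hs v⟩)
  have : Module.Finite F (σ →₀ F) := Module.Finite.equiv e
  exact Module.Finite.finite_basis (Finsupp.basisSingleOne (R := F) (ι := σ))

/-- The variables stay linearly independent in the quotient. This supplies finiteness for `H`, which
is not assumed finite-dimensional. -/
theorem finite_of_finite_abelianQuotient [Fact p.Prime]
    [Module.Finite F (MvPolynomial σ F ⧸ Ideal.span (Set.range (abelianRel p q s)))] :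
    Finite σ := by
  let f : (σ →₀ F) →ₗ[F] (MvPolynomial σ F ⧸ Ideal.span (Set.range (abelianRel p q s))) :=
    (Ideal.Quotient.mkₐ F _).toLinearMap ∘ₗ Finsupp.linearCombination F X
  have hf : Function.Injective f := by
    rw [injective_iff_map_eq_zero]
    intro v hv
    exact eq_zero_of_linearCombination_X_mem _ (Fact.out : p.Prime).one_lt
      (abelianRel_sub_mem q s) (Ideal.Quotient.eq_zero_iff_mem.1 hv)
  have : Module.Finite F (σ →₀ F) := Module.Finite.of_injective f hf
  exact Module.Finite.finite_basis (Finsupp.basisSingleOne (R := F) (ι := σ))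

variable {H : Type*} [LieRing H] [LieAlgebra F H] [RestrictedLieAlgebra p F H]

/-- The dimension of `L / L'_p` is determined by `u(L)`. -/
theorem finrank_quotient_derivedRestricted_eq [Fact p.Prime] [CharP F p]
    [FiniteDimensional F (L ⧸ (derivedRestricted p F L).toSubmodule)]
    (e : RestrictedEnveloping p F L ≃ₐ[F] RestrictedEnveloping p F H) :
    FiniteDimensional F (H ⧸ (derivedRestricted p F H).toSubmodule) ∧
      Module.finrank F (L ⧸ (derivedRestricted p F L).toSubmodule) =
        Module.finrank F (H ⧸ (derivedRestricted p F H).toSubmodule) := by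
  obtain ⟨σ, q, s, hq, hs⟩ := exists_section p F L
  obtain ⟨τ, q', s', hq', hs'⟩ := exists_section p F H
  obtain ⟨E⟩ := nonempty_abelianQuotient_equiv hq hs hq' hs' e
  have := finite_of_quotient_derivedRestricted hq hs
  have hp := (Fact.out : p.Prime).one_lt
  obtain ⟨h₁, h₂⟩ := finrank_quotient_span _ hp (abelianRel_sub_mem q s)
  have : Module.Finite F (MvPolynomial τ F ⧸ Ideal.span (Set.range (abelianRel p q' s'))) :=
    Module.Finite.equiv E.toLinearEquiv
  have := finite_of_finite_abelianQuotient (p := p) (q := q') (s := s')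
  obtain ⟨-, h₂'⟩ := finrank_quotient_span _ hp (abelianRel_sub_mem q' s')
  obtain ⟨-, h₃⟩ := finrank_quotient_derivedRestricted hq hs
  obtain ⟨h₄, h₅⟩ := finrank_quotient_derivedRestricted hq' hs'
  refine ⟨h₄, ?_⟩
  rw [h₃, h₅]
  -- The isomorphic commutative quotients have dimensions `p ^ |σ|` and `p ^ |τ|`.
  refine Nat.pow_right_injective hp ?_
  change p ^ _ = p ^ _
  rw [← h₂, ← h₂', E.toLinearEquiv.finrank_eq]

/-- If `L` is `p`-nilpotent, then the augmentation is the only algebra map `u(L) → F`. -/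
theorem algHom_eq_augmentation [Fact p.Prime] (hL : IsPNilpotent p F L)
    (f : RestrictedEnveloping p F L →ₐ[F] F) : f = augmentation p F L := by
  refine restrictedEnveloping_hom_ext fun x => ?_
  -- By `p`-nilpotence the right side vanishes for some `n`, so `f` sends `x` to a nilpotent element
  -- of a field.
  have h : ∀ (n : ℕ) (x : L), f (uι p F L x) ^ p ^ n = f (uι p F L ((pMap p F)^[n] x)) := by
    intro n
    induction n with
    | zero => intro x; simp
    | succ n ih =>
      intro x
      rw [Function.iterate_succ_apply, ← ih, pow_succ', pow_mul, ← map_pow, uι_pow]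
  obtain ⟨n, hn⟩ := hL x
  have h' := h n x
  rw [hn, map_zero, map_zero] at h'
  rw [augmentation_uι, eq_zero_of_pow_eq_zero h']

theorem map_commutatorSpan {U V : Type*} [Ring U] [Algebra F U] [Ring V] [Algebra F V]
    (e : U ≃ₐ[F] V) :
    (commutatorSpan F U).map e.toAlgHom.toLinearMap = commutatorSpan F V := by
  rw [commutatorSpan, commutatorSpan, Submodule.map_span]
  congr 1
  ext c
  constructor
  · rintro ⟨_, ⟨a, b, rfl⟩, rfl⟩
    exact ⟨e a, e b, by simp⟩
  · rintro ⟨a, b, rfl⟩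
    exact ⟨_, ⟨e.symm a, e.symm b, rfl⟩, by simp⟩

theorem map_derivedMulU [Fact p.Prime] (e : RestrictedEnveloping p F L ≃ₐ[F] RestrictedEnveloping p F H) :
    (derivedMulU p F L).map e.toAlgHom.toLinearMap = derivedMulU p F H := by
  have htop : (⊤ : Submodule F (RestrictedEnveloping p F L)).map e.toAlgHom.toLinearMap = ⊤ := by
    rw [Submodule.map_top]
    exact LinearMap.range_eq_top.2 e.surjective
  rw [derivedMulU_eq_commutatorSpan_mul, derivedMulU_eq_commutatorSpan_mul, Submodule.map_mul,
    map_commutatorSpan, htop]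

/-- Only `L` has to be `p`-nilpotent: the augmentation of `u(H)` pulled back along `e` is an algebra
map `u(L) → F`, hence the augmentation of `u(L)`. -/
theorem map_augmentationIdeal [Fact p.Prime] (hL : IsPNilpotent p F L)
    (e : RestrictedEnveloping p F L ≃ₐ[F] RestrictedEnveloping p F H) :
    (augmentationIdeal p F L).map e.toAlgHom.toLinearMap = augmentationIdeal p F H := by
  have h : ∀ a, augmentation p F H (e a) = augmentation p F L a := fun a =>
    DFunLike.congr_fun (algHom_eq_augmentation hL ((augmentation p F H).comp e.toAlgHom)) a
  ext b
  constructor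
  · rintro ⟨a, ha, rfl⟩
    exact (h a).trans ha
  · intro hb
    refine ⟨e.symm b, ?_, e.apply_symm_apply b⟩
    change augmentation p F L (e.symm b) = 0
    rw [← h, e.apply_symm_apply]
    exact hb

theorem map_idealJ [Fact p.Prime] (hL : IsPNilpotent p F L)
    (e : RestrictedEnveloping p F L ≃ₐ[F] RestrictedEnveloping p F H) :
    (idealJ p F L).map e.toAlgHom.toLinearMap = idealJ p F H := by
  rw [idealJ_eq, idealJ_eq, Submodule.map_sup, Submodule.map_mul, Submodule.map_mul,
    map_derivedMulU, map_augmentationIdeal hL]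

end universal

/-! ### Dimension count and conclusion -/

theorem nonempty_quotient_submoduleOf_equiv {F U V : Type*} [Field F] [AddCommGroup U]
    [Module F U] [AddCommGroup V] [Module F V] (e : U ≃ₗ[F] V) (C J : Submodule F U) :
    Nonempty ((C ⧸ J.submoduleOf C) ≃ₗ[F]
      (C.map e.toLinearMap ⧸ (J.map e.toLinearMap).submoduleOf (C.map e.toLinearMap))) := by
  refine ⟨Submodule.Quotient.equiv _ _ (e.submoduleMap C) ?_⟩
  ext ⟨y, hy⟩
  constructor
  · rintro ⟨⟨x, hx⟩, hxJ, hxy⟩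
    exact ⟨x, hxJ, congrArg Subtype.val hxy⟩
  · rintro ⟨x, hxJ, hxy⟩
    obtain ⟨x', hx', hxy'⟩ := hy
    obtain rfl : x = x' := e.injective (hxy.trans hxy'.symm)
    exact ⟨⟨x, hx'⟩, hxJ, Subtype.ext hxy⟩

theorem finrank_quotient_eq_add {F V : Type*} [Field F] [AddCommGroup V] [Module F V]
    {K D : Submodule F V} (hKD : K ≤ D) [FiniteDimensional F (V ⧸ D)]
    [FiniteDimensional F (D ⧸ K.submoduleOf D)] :
    FiniteDimensional F (V ⧸ K) ∧ Module.finrank F (V ⧸ K) =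
      Module.finrank F (V ⧸ D) + Module.finrank F (D ⧸ K.submoduleOf D) := by
  let e₁ := Submodule.quotientQuotientEquivQuotient K D hKD
  have hker : LinearMap.ker (K.mkQ.domRestrict D) = K.submoduleOf D := by
    ext x
    simp [Submodule.submoduleOf]
  have hrange : LinearMap.range (K.mkQ.domRestrict D) = D.map K.mkQ :=
    LinearMap.range_domRestrict _ _
  let e₂ : (D ⧸ K.submoduleOf D) ≃ₗ[F] D.map K.mkQ :=
    (Submodule.quotEquivOfEq _ _ hker.symm).trans
      ((K.mkQ.domRestrict D).quotKerEquivRange.trans (LinearEquiv.ofEq _ _ hrange))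
  have : Module.Finite F (D.map K.mkQ) := Module.Finite.equiv e₂
  have : Module.Finite F ((V ⧸ K) ⧸ D.map K.mkQ) := Module.Finite.equiv e₁.symm
  have hfin : Module.Finite F (V ⧸ K) := Module.Finite.of_submodule_quotient (D.map K.mkQ)
  refine ⟨hfin, ?_⟩
  rw [← Submodule.finrank_quotient_add_finrank (D.map K.mkQ), e₁.finrank_eq, e₂.finrank_eq]

end RestrictedLieAlgebra

theorem mainTheorem6 {p : ℕ} [Fact p.Prime] {F : Type*} [Field F] [CharP F p]
    {L : Type*} [LieRing L] [LieAlgebra F L] [RestrictedLieAlgebra p F L]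
    [FiniteDimensional F L] (hL : RestrictedLieAlgebra.IsPNilpotent p F L) :
    (∀ (H : Type*) [LieRing H] [LieAlgebra F H] [RestrictedLieAlgebra p F H],
      Nonempty (RestrictedLieAlgebra.RestrictedEnveloping p F L ≃ₐ[F]
        RestrictedLieAlgebra.RestrictedEnveloping p F H) →
      FiniteDimensional F (H ⧸ RestrictedLieAlgebra.derivedPowerAddGamma p F H) ∧
      Module.finrank F (L ⧸ RestrictedLieAlgebra.derivedPowerAddGamma p F L) =
        Module.finrank F (H ⧸ RestrictedLieAlgebra.derivedPowerAddGamma p F H)) ∧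
    (∃ e : ((RestrictedLieAlgebra.derivedRestricted p F L).toSubmodule ⧸
          (RestrictedLieAlgebra.derivedPowerAddGamma p F L).submoduleOf
            (RestrictedLieAlgebra.derivedRestricted p F L).toSubmodule) ≃ₗ[F]
        (RestrictedLieAlgebra.derivedMulU p F L ⧸
          (RestrictedLieAlgebra.idealJ p F L).submoduleOf
            (RestrictedLieAlgebra.derivedMulU p F L)),
      ∀ x : (RestrictedLieAlgebra.derivedRestricted p F L).toSubmodule,
        e (Submodule.Quotient.mk x) =
          Submodule.Quotient.mk ⟨RestrictedLieAlgebra.uι p F L x,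
            RestrictedLieAlgebra.uι_mem_derivedMulU p F L x⟩) := by
  refine ⟨?_, RestrictedLieAlgebra.exists_equiv_derivedMulU_quotient⟩
  intro H _ _ _ ⟨e⟩
  obtain ⟨E, -⟩ := RestrictedLieAlgebra.exists_equiv_derivedMulU_quotient (p := p) (F := F) (L := L)
  obtain ⟨E', -⟩ := RestrictedLieAlgebra.exists_equiv_derivedMulU_quotient (p := p) (F := F) (L := H)
  obtain ⟨G⟩ := RestrictedLieAlgebra.nonempty_quotient_submoduleOf_equiv e.toLinearEquiv
    (RestrictedLieAlgebra.derivedMulU p F L) (RestrictedLieAlgebra.idealJ p F L)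
  have hC : (RestrictedLieAlgebra.derivedMulU p F L).map e.toLinearEquiv.toLinearMap =
      RestrictedLieAlgebra.derivedMulU p F H := RestrictedLieAlgebra.map_derivedMulU e
  have hJ : (RestrictedLieAlgebra.idealJ p F L).map e.toLinearEquiv.toLinearMap =
      RestrictedLieAlgebra.idealJ p F H := RestrictedLieAlgebra.map_idealJ hL e
  rw [hC, hJ] at G
  -- Part (2) is applied to both `L` and `H`; it needs neither finite dimension nor `p`-nilpotence,
  -- so it is available for `H`.
  have E₀ := (E.trans G).trans E'.symm
  have := Module.Finite.equiv E₀
  obtain ⟨_, h₁⟩ := RestrictedLieAlgebra.finrank_quotient_derivedRestricted_eq e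
  obtain ⟨-, h₂⟩ := RestrictedLieAlgebra.finrank_quotient_eq_add
    (RestrictedLieAlgebra.derivedPowerAddGamma_le (p := p) (F := F) (L := L))
  obtain ⟨h₃, h₄⟩ := RestrictedLieAlgebra.finrank_quotient_eq_add
    (RestrictedLieAlgebra.derivedPowerAddGamma_le (p := p) (F := F) (L := H))
  exact ⟨h₃, by rw [h₂, h₄, h₁, E₀.finrank_eq]⟩
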